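/- Let $\mathcal A\subseteq B(\mathcal H)$ be a von Neumann algebra on a complex Hilbert space $\mathcal H$ and let $\tau:\mathcal A\to\mathcal A$ be a normal unital completely positive map. A minimal dilation of $\tau$ is a triple $(\mathcal K,\mathcal B,\theta)$, where $\mathcal K\supseteq\mathcal H$ is a Hilbert space, $p$ is the orthogonal projection of $\mathcal K$ onto $\mathcal H$ (operators $x$ on $\mathcal H$ being identified with the operators $pxp$ on $\mathcal K$), $\mathcal B\subseteq B(\mathcal K)$ is a von Neumann algebra with $\mathcal A\subseteq\mathcal B$ and $p\mathcal Bp=\mathcal A$, and $\theta:\mathcal B\to\mathcal B$ is a normal unital $*$-endomorphism such that $\tau^n(x)=p\,\theta^n(x)\,p$ for all $x\in\mathcal A$, $n\ge 0$, such that $\mathcal K$ is the closed linear span of the vectors $\theta^n(x_n)\theta^{n-1}(x_{n-1})\cdots\theta(x_1)h$ ($n\ge 0$, $x_j\in\mathcal A$, $h\in\mathcal H$), and such that $\mathcal B$ is the von Neumann algebra generated by $\{\theta^n(x): n\ge 0,\ x\in\mathcal A\}$. Let $$\mathcal P(\tau)=\overline{\operatorname{span}}\{x\in\mathcal A:\tau(x)=\lambda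 x\text{ for some }\lambda\in\mathbb C,\ |\lambda|=1\}$$ (norm closure), and define $\mathcal P(\theta)\subseteq\mathcal B$, a unital $C^*$-subalgebra of $\mathcal B$, in the same way. The compression $T:\mathcal P(\theta)\to\mathcal P(\tau)$, $T(z)=pzp$, is an isometric linear bijection, and with the norm, involution and unit of $\mathcal A$ and the product $x\circ y:=T\big(T^{-1}(x)T^{-1}(y)\big)$ the space $\mathcal P(\tau)$ is a unital $C^*$-algebra, the peripheral Poisson boundary of $\tau$. Theorem. The map $\tau$ has a minimal dilation. For every minimal dilation of $\tau$ and the corresponding product $\circ$, the restriction $\alpha:x\mapsto\tau(x)$ of $\tau$ to $\mathcal P(\tau)$ is a $*$-automorphism of the unital $C^*$-algebra $(\mathcal P(\tau),\circ)$. The peripheral Poisson boundary of this automorphism (for a $*$-automorphism of a unital $C^*$-algebra: the $C^*$-subalgebra that is the norm-closed linear span of its eigenvectors with eigenvalues of modulus one) is all of $(\mathcal P(\tau),\circ)$. -/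

import Mathlib

open Filter Topology
open scoped CStarAlgebra

universe u

/-! ## Von Neumann algebras as ordered C*-algebras -/

namespace VonNeumannAlgebra

variable {H : Type u} [NormedAddCommGroup H] [InnerProductSpace ℂ H] [CompleteSpace H]

instance instSMulMemClass : SMulMemClass (VonNeumannAlgebra H) ℂ (H →L[ℂ] H) where
  smul_mem {s} c x hx := show c • x ∈ s.toStarSubalgebra from s.toStarSubalgebra.smul_mem hx c

instance instIsClosed (A : VonNeumannAlgebra H) : IsClosed (A : Set (H →L[ℂ] H)) := by
  rw [← A.centralizer_centralizer]
  exact Set.isClosed_centralizer _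

/-- The order on a von Neumann algebra `A ⊆ B(H)` is the operator order inherited from `B(H)`;
with it, `A` is a star-ordered ring. -/
instance instStarOrderedRing (A : VonNeumannAlgebra H) : StarOrderedRing A := by
  refine StarOrderedRing.of_nonneg_iff' (fun {x y} h z => ?_) (fun x => ⟨fun h => ?_, ?_⟩)
  · change (z : H →L[ℂ] H) + x ≤ z + y
    have h' : (x : H →L[ℂ] H) ≤ y := h
    gcongr
  · have h' : (0 : H →L[ℂ] H) ≤ x := h
    have hsa' : IsSelfAdjoint (x : H →L[ℂ] H) := IsSelfAdjoint.of_nonneg h'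
    have hsa : IsSelfAdjoint x := Subtype.ext hsa'
    have h1 : SpectrumRestricts (x : H →L[ℂ] H) ContinuousMap.realToNNReal :=
      (nonneg_iff_isSelfAdjoint_and_quasispectrumRestricts.mp h').2
    have h2 : SpectrumRestricts x ContinuousMap.realToNNReal := by
      rw [SpectrumRestricts.nnreal_iff_nnnorm hsa le_rfl]
      exact (SpectrumRestricts.nnreal_iff_nnnorm hsa' le_rfl).mp h1
    obtain ⟨s, hs, -, hs'⟩ := CFC.exists_sqrt_of_isSelfAdjoint_of_quasispectrumRestricts hsa h2
    exact ⟨s, by rw [hs.star_eq, hs']⟩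
  · rintro ⟨s, rfl⟩
    change (0 : H →L[ℂ] H) ≤ star (s : H →L[ℂ] H) * s
    exact star_mul_self_nonneg _

end VonNeumannAlgebra

/-- A map between ordered *-algebras is *normal* if it preserves the suprema of
(bounded) increasing nets of self-adjoint elements. -/
def IsNormalMap {A B : Type*} [Star A] [LE A] [LE B] (f : A → B) : Prop :=
  ∀ S : Set A, S.Nonempty → (∀ s ∈ S, IsSelfAdjoint s) → DirectedOn (· ≤ ·) S →
    ∀ x, IsLUB S x → IsLUB (f '' S) (f x)

/-- Normal unital completely positive (UCP) maps `τ : A → A` on a von Neumann algebra `A`. -/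
structure NormalUCPMap {H : Type u} [NormedAddCommGroup H] [InnerProductSpace ℂ H]
    [CompleteSpace H] (A : VonNeumannAlgebra H) extends A →CP A where
  map_one' : toFun 1 = 1
  normal' : IsNormalMap toFun

namespace NormalUCPMap

variable {H : Type u} [NormedAddCommGroup H] [InnerProductSpace ℂ H] [CompleteSpace H]
  {A : VonNeumannAlgebra H}

noncomputable instance : CoeFun (NormalUCPMap A) (fun _ => A → A) where
  coe τ := τ.toLinearMap

theorem map_one (τ : NormalUCPMap A) : τ 1 = 1 := τ.map_one'

end NormalUCPMap

/-! ## Peripheral eigenvectors -/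

/-- The peripheral eigenvectors (together with `0`): all `x` with `f x = c • x` for some `c` on
the unit circle. -/
def peripheralEigenvectors {E : Type*} [AddCommGroup E] [Module ℂ E] (f : E →ₗ[ℂ] E) : Set E :=
  {x | ∃ c : ℂ, ‖c‖ = 1 ∧ f x = c • x}

/-- The norm-closed linear span of the peripheral eigenvectors. -/
def peripheralSpace {E : Type*} [NormedAddCommGroup E] [NormedSpace ℂ E] (f : E →ₗ[ℂ] E) :
    Submodule ℂ E :=
  (Submodule.span ℂ (peripheralEigenvectors f)).topologicalClosure

/-- For a unital *-endomorphism `φ` of a unital C*-algebra, `peripheralSpace φ` is a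
C*-subalgebra. This C*-subalgebra, with its own product, is the peripheral Poisson boundary
of `φ` (a *-endomorphism is its own minimal dilation). -/
def peripheralSubalgebra {C : Type*} [CStarAlgebra C] (φ : C →⋆ₐ[ℂ] C) : StarSubalgebra ℂ C where
  carrier := peripheralSpace (φ : C →ₗ[ℂ] C)
  zero_mem' := zero_mem _
  add_mem' := add_mem
  algebraMap_mem' c := by
    rw [Algebra.algebraMap_eq_smul_one]
    exact Submodule.smul_mem _ _ (Submodule.le_topologicalClosure _
      (Submodule.subset_span ⟨1, by simp, by simp⟩))
  mul_mem' {a b} ha hb := by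
    refine map_mem_closure₂ (u := (Submodule.span ℂ (peripheralEigenvectors (φ : C →ₗ[ℂ] C)) :
      Set C)) continuous_mul ha hb (fun a ha b hb => ?_)
    have hmul : ∀ x ∈ peripheralEigenvectors (φ : C →ₗ[ℂ] C),
        ∀ y ∈ peripheralEigenvectors (φ : C →ₗ[ℂ] C),
        x * y ∈ peripheralEigenvectors (φ : C →ₗ[ℂ] C) := by
      rintro x ⟨c, hc, hx⟩ y ⟨d, hd, hy⟩
      refine ⟨c * d, by simp [hc, hd], ?_⟩
      have hx' : φ x = c • x := hx
      have hy' : φ y = d • y := hy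
      change φ (x * y) = _
      rw [map_mul, hx', hy', smul_mul_smul_comm]
    change a * b ∈ Submodule.span ℂ _
    have := Submodule.mul_mem_mul (show a ∈ Submodule.span ℂ _ from ha)
      (show b ∈ Submodule.span ℂ _ from hb)
    rw [Submodule.span_mul_span] at this
    refine Submodule.span_mono ?_ this
    rintro _ ⟨x, hx, y, hy, rfl⟩
    exact hmul x hx y hy
  star_mem' {a} ha := by
    refine map_mem_closure (t := (Submodule.span ℂ (peripheralEigenvectors (φ : C →ₗ[ℂ] C)) :
      Set C)) continuous_star ha (fun a ha => ?_)
    induction (show a ∈ Submodule.span ℂ _ from ha) using Submodule.span_induction with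
    | mem x hx =>
      obtain ⟨c, hc, hx⟩ := hx
      refine Submodule.subset_span ⟨star c, by simpa using hc, ?_⟩
      have hx' : φ x = c • x := hx
      change φ (star x) = _
      rw [map_star, hx', star_smul]
    | zero => simp
    | add x y hx hy h1 h2 =>
      rw [star_add]
      exact add_mem (h1 hx) (h2 hy)
    | smul c x hx h =>
      rw [star_smul]
      exact Submodule.smul_mem _ _ (h hx)

instance {C : Type*} [CStarAlgebra C] (φ : C →⋆ₐ[ℂ] C) :
    IsClosed (peripheralSubalgebra φ : Set C) :=
  Submodule.isClosed_topologicalClosure (Submodule.span ℂ (peripheralEigenvectors (φ : C →ₗ[ℂ] C)))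

/-! ## Minimal dilations -/

section Dilation

variable {H K : Type u} [NormedAddCommGroup H] [InnerProductSpace ℂ H] [CompleteSpace H]
  [NormedAddCommGroup K] [InnerProductSpace ℂ K] [CompleteSpace K]

/-- The identification of `a ∈ B(H)` with an operator on `K ⊇ H` (zero on the orthogonal
complement of `H`). -/
noncomputable def extendOp (V : H →ₗᵢ[ℂ] K) (a : H →L[ℂ] H) : K →L[ℂ] K :=
  V.toContinuousLinearMap ∘L a ∘L V.toContinuousLinearMap.adjoint

/-- The compression of `b ∈ B(K)` to the subspace `H ⊆ K`. -/
noncomputable def compressOp (V : H →ₗᵢ[ℂ] K) (b : K →L[ℂ] K) : H →L[ℂ] H :=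
  V.toContinuousLinearMap.adjoint ∘L b ∘L V.toContinuousLinearMap

/-- `dilationWord θ x n = θⁿ(xₙ) θⁿ⁻¹(xₙ₋₁) ⋯ θ(x₁)`. -/
def dilationWord {R : Type*} [Monoid R] (θ : R → R) (x : ℕ → R) : ℕ → R
  | 0 => 1
  | n + 1 => θ^[n + 1] (x (n + 1)) * dilationWord θ x n

end Dilation

/-- A minimal dilation `(K, B, θ)` of a normal UCP map `τ` on a von Neumann algebra
`A ⊆ B(H)`: the Hilbert space `H` is a closed subspace of `K` through the isometry `incl`,
and `a ∈ B(H)` is regarded as the operator `extendOp incl a` on `K`. -/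
structure MinimalDilation {H : Type u} [NormedAddCommGroup H] [InnerProductSpace ℂ H]
    [CompleteSpace H] {A : VonNeumannAlgebra H} (τ : NormalUCPMap A) where
  K : Type u
  [normedAddCommGroup : NormedAddCommGroup K]
  [innerProductSpace : InnerProductSpace ℂ K]
  [completeSpace : CompleteSpace K]
  /-- the inclusion of `H` into `K` -/
  incl : H →ₗᵢ[ℂ] K
  B : VonNeumannAlgebra K
  /-- `A ⊆ B` -/
  extend_mem (a : A) : extendOp incl a ∈ B
  /-- `pBp ⊆ A` -/
  compress_mem (b : B) : compressOp incl b ∈ A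
  /-- the unital *-endomorphism -/
  θ : B →⋆ₐ[ℂ] B
  normal : IsNormalMap θ
  /-- the dilation property `τⁿ(a) = p θⁿ(a) p` -/
  dilation (n : ℕ) (a : A) :
    compressOp incl (θ^[n] ⟨extendOp incl a, extend_mem a⟩ : B) = (τ^[n] a : A)
  /-- minimality of the space -/
  minimal_space : Dense (Submodule.span ℂ
    {k : K | ∃ (n : ℕ) (x : ℕ → A) (h : H),
      k = ((dilationWord θ (fun j => ⟨extendOp incl (x j), extend_mem (x j)⟩) n : B) :
        K →L[ℂ] K) (incl h)}
    : Set K)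
  /-- minimality of the algebra: `B` is the von Neumann algebra generated by all `θⁿ(a)` -/
  minimal_algebra : (B : Set (K →L[ℂ] K)) = Set.centralizer (Set.centralizer
    {b : K →L[ℂ] K | ∃ (n : ℕ) (a : A), b = (θ^[n] ⟨extendOp incl a, extend_mem a⟩ : B)})

namespace MinimalDilation

attribute [instance] normedAddCommGroup innerProductSpace completeSpace

variable {H : Type u} [NormedAddCommGroup H] [InnerProductSpace ℂ H] [CompleteSpace H]
  {A : VonNeumannAlgebra H} {τ : NormalUCPMap A} (D : MinimalDilation τ)

/-- The elements of `A`, regarded as elements of `B`. -/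
noncomputable def extend (a : A) : D.B := ⟨extendOp D.incl a, D.extend_mem a⟩

/-- The compression `b ↦ pbp` from `B` to `A`. -/
noncomputable def compress : D.B →ₗ[ℂ] A where
  toFun b := ⟨compressOp D.incl b, D.compress_mem b⟩
  map_add' x y := by
    apply Subtype.ext
    simp [compressOp]
  map_smul' c x := by
    apply Subtype.ext
    simp [compressOp]

theorem adjoint_incl (h : H) : D.incl.toContinuousLinearMap.adjoint (D.incl h) = h := by
  refine ext_inner_right ℂ (fun v => ?_)
  rw [ContinuousLinearMap.adjoint_inner_left]
  simp

@[simp] theorem extend_apply (a : A) (k : D.K) : (D.extend a : D.K →L[ℂ] D.K) k =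
    D.incl ((a : H →L[ℂ] H) (D.incl.toContinuousLinearMap.adjoint k)) := rfl

@[simp] theorem compress_apply (b : D.B) (h : H) : (D.compress b : H →L[ℂ] H) h =
    D.incl.toContinuousLinearMap.adjoint ((b : D.K →L[ℂ] D.K) (D.incl h)) := rfl

theorem compress_extend (a : A) : D.compress (D.extend a) = a := by
  apply Subtype.ext
  ext h
  simp [adjoint_incl]

theorem norm_compress_le (b : D.B) : ‖D.compress b‖ ≤ ‖b‖ := by
  change ‖(D.compress b : H →L[ℂ] H)‖ ≤ ‖(b : D.K →L[ℂ] D.K)‖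
  refine ContinuousLinearMap.opNorm_le_bound _ (norm_nonneg _) (fun h => ?_)
  rw [compress_apply]
  have h1 : ‖D.incl.toContinuousLinearMap.adjoint‖ ≤ 1 := by
    rw [LinearIsometryEquiv.norm_map]
    exact D.incl.norm_toContinuousLinearMap_le
  calc _ ≤ 1 * ‖(b : D.K →L[ℂ] D.K) (D.incl h)‖ := ContinuousLinearMap.le_of_opNorm_le _ h1 _
    _ ≤ 1 * (‖(b : D.K →L[ℂ] D.K)‖ * ‖D.incl h‖) := by gcongr; exact ContinuousLinearMap.le_opNorm _ _
    _ = _ := by simp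

theorem norm_extend_le (a : A) : ‖D.extend a‖ ≤ ‖a‖ := by
  change ‖(D.extend a : D.K →L[ℂ] D.K)‖ ≤ ‖(a : H →L[ℂ] H)‖
  refine ContinuousLinearMap.opNorm_le_bound _ (norm_nonneg _) (fun h => ?_)
  rw [extend_apply, LinearIsometry.norm_map]
  have h1 : ‖D.incl.toContinuousLinearMap.adjoint‖ ≤ 1 := by
    rw [LinearIsometryEquiv.norm_map]
    exact D.incl.norm_toContinuousLinearMap_le
  calc _ ≤ ‖(a : H →L[ℂ] H)‖ * ‖D.incl.toContinuousLinearMap.adjoint h‖ :=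
        ContinuousLinearMap.le_opNorm _ _
    _ ≤ ‖(a : H →L[ℂ] H)‖ * (1 * ‖h‖) := by
        gcongr
        exact ContinuousLinearMap.le_of_opNorm_le _ h1 _
    _ = _ := by simp

theorem compress_star (b : D.B) : D.compress (star b) = star (D.compress b) := by
  apply Subtype.ext
  change compressOp D.incl (star (b : D.K →L[ℂ] D.K)) = star (compressOp D.incl b)
  simp only [compressOp, ContinuousLinearMap.star_eq_adjoint, ContinuousLinearMap.adjoint_comp,
    ContinuousLinearMap.adjoint_adjoint]
  rfl

/-- The projection `p` of `K` onto `H`. -/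
noncomputable def proj : D.B := D.extend 1

theorem extend_compress (b : D.B) : D.extend (D.compress b) = D.proj * b * D.proj := by
  apply Subtype.ext
  ext k
  simp [proj]

theorem compress_one : D.compress 1 = 1 := by
  apply Subtype.ext
  ext h
  simp [adjoint_incl]

theorem extend_mul (a b : A) : D.extend a * D.extend b = D.extend (a * b) := by
  apply Subtype.ext
  ext k
  simp [adjoint_incl]

theorem extend_star (a : A) : star (D.extend a) = D.extend (star a) := by
  apply Subtype.ext
  change star (extendOp D.incl a) = extendOp D.incl (star (a : H →L[ℂ] H))
  simp only [extendOp, ContinuousLinearMap.star_eq_adjoint, ContinuousLinearMap.adjoint_comp,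
    ContinuousLinearMap.adjoint_adjoint]
  rfl

theorem extend_inj {a b : A} (h : D.extend a = D.extend b) : a = b := by
  rw [← D.compress_extend a, h, D.compress_extend]

theorem proj_mul_proj : D.proj * D.proj = D.proj := by
  simp [proj, extend_mul]

theorem star_proj : star D.proj = D.proj := by
  simp [proj, extend_star]

theorem compress_theta_extend (a : A) : D.compress (D.θ (D.extend a)) = τ a :=
  Subtype.ext (D.dilation 1 a)

theorem theta_proj_mul_proj : D.θ D.proj * D.proj = D.proj := by
  have h1 : D.proj * D.θ D.proj * D.proj = D.proj := by
    rw [← extend_compress, proj, compress_theta_extend, τ.map_one]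
  have h2 : star ((1 - D.θ D.proj) * D.proj) * ((1 - D.θ D.proj) * D.proj) = 0 := by
    have h3 : star (D.θ D.proj) = D.θ D.proj := by rw [← map_star, star_proj]
    have h4 : D.θ D.proj * D.θ D.proj = D.θ D.proj := by rw [← map_mul, proj_mul_proj]
    rw [star_mul, star_sub, star_one, star_proj, h3]
    calc _ = D.proj * D.proj - 2 • (D.proj * D.θ D.proj * D.proj)
          + D.proj * (D.θ D.proj * D.θ D.proj) * D.proj := by noncomm_ring
      _ = 0 := by
        rw [h4, h1, proj_mul_proj]
        noncomm_ring
  have h5 := CStarRing.star_mul_self_eq_zero_iff _ |>.mp h2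
  rw [sub_mul, one_mul, sub_eq_zero] at h5
  exact h5.symm

theorem proj_mul_theta_proj : D.proj * D.θ D.proj = D.proj := by
  have := congrArg star D.theta_proj_mul_proj
  rwa [star_mul, ← map_star, star_proj] at this

theorem compress_theta (b : D.B) : D.compress (D.θ b) = τ (D.compress b) := by
  rw [← compress_theta_extend, extend_compress]
  apply D.extend_inj
  rw [extend_compress, extend_compress, map_mul, map_mul]
  calc _ = (D.proj * D.θ D.proj) * D.θ b * (D.θ D.proj * D.proj) := by
        rw [proj_mul_theta_proj, theta_proj_mul_proj]
    _ = _ := by noncomm_ring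

/-- `projN n = θⁿ(p)`. -/
noncomputable def projN (n : ℕ) : D.B := D.θ^[n] D.proj

theorem iterate_mul (n : ℕ) (a b : D.B) : D.θ^[n] (a * b) = D.θ^[n] a * D.θ^[n] b := by
  induction n generalizing a b with
  | zero => rfl
  | succ n ih => simp

theorem iterate_star (n : ℕ) (a : D.B) : D.θ^[n] (star a) = star (D.θ^[n] a) := by
  induction n generalizing a with
  | zero => rfl
  | succ n ih => simp [ih, map_star]

theorem iterate_sub (n : ℕ) (a b : D.B) : D.θ^[n] (a - b) = D.θ^[n] a - D.θ^[n] b := by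
  induction n generalizing a b with
  | zero => rfl
  | succ n ih => simp

theorem iterate_add (n : ℕ) (a b : D.B) : D.θ^[n] (a + b) = D.θ^[n] a + D.θ^[n] b := by
  induction n generalizing a b with
  | zero => rfl
  | succ n ih => simp

theorem iterate_smul (n : ℕ) (c : ℂ) (a : D.B) : D.θ^[n] (c • a) = c • D.θ^[n] a := by
  induction n generalizing a with
  | zero => rfl
  | succ n ih => simp [ih]

theorem norm_iterate_le (n : ℕ) (a : D.B) : ‖D.θ^[n] a‖ ≤ ‖a‖ := by
  induction n generalizing a with
  | zero => simp
  | succ n ih =>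
    rw [Function.iterate_succ_apply]
    exact (ih _).trans (NonUnitalStarAlgHom.norm_apply_le D.θ a)

theorem projN_mul_self (n : ℕ) : D.projN n * D.projN n = D.projN n := by
  rw [projN, ← iterate_mul, proj_mul_proj]

theorem star_projN (n : ℕ) : star (D.projN n) = D.projN n := by
  rw [projN, ← iterate_star, star_proj]

theorem projN_mul_of_le {m n : ℕ} (h : m ≤ n) : D.projN n * D.projN m = D.projN m := by
  induction n, h using Nat.le_induction with
  | base => exact D.projN_mul_self m
  | succ n h ih =>
    have h1 : D.projN (n + 1) * D.projN n = D.projN n := by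
      rw [projN, projN, Function.iterate_succ_apply, ← iterate_mul, theta_proj_mul_proj]
    rw [← ih, ← mul_assoc, h1]

theorem mul_projN_of_le {m n : ℕ} (h : m ≤ n) : D.projN m * D.projN n = D.projN m := by
  have := congrArg star (D.projN_mul_of_le h)
  rwa [star_mul, star_projN, star_projN] at this

theorem norm_projN_le (n : ℕ) : ‖D.projN n‖ ≤ 1 := by
  refine (D.norm_iterate_le n _).trans ((D.norm_extend_le 1).trans ?_)
  exact ContinuousLinearMap.norm_id_le

theorem projN_mul_word (x : ℕ → A) (n : ℕ) :
    D.projN n * (dilationWord D.θ (fun j => D.extend (x j)) n * D.proj) =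
      dilationWord D.θ (fun j => D.extend (x j)) n * D.proj := by
  cases n with
  | zero => simp [dilationWord, projN, proj_mul_proj]
  | succ n =>
    rw [dilationWord, ← mul_assoc, ← mul_assoc, projN, ← iterate_mul, proj, extend_mul, one_mul]

/-- `θⁿ(p)` converges strongly to the identity of `K`. -/
theorem tendsto_projN (k : D.K) :
    Tendsto (fun n => (D.projN n : D.K →L[ℂ] D.K) k) atTop (𝓝 k) := by
  have hw : ∀ k ∈ Submodule.span ℂ {k : D.K | ∃ (n : ℕ) (x : ℕ → A) (h : H),
      k = ((dilationWord D.θ (fun j => D.extend (x j)) n : D.B) : D.K →L[ℂ] D.K) (D.incl h)},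
      ∃ N, ∀ n ≥ N, (D.projN n : D.K →L[ℂ] D.K) k = k := by
    intro k hk
    induction hk using Submodule.span_induction with
    | mem k hk =>
      obtain ⟨n, x, h, rfl⟩ := hk
      refine ⟨n, fun m hm => ?_⟩
      have h1 : ((dilationWord D.θ (fun j => D.extend (x j)) n : D.B) : D.K →L[ℂ] D.K) (D.incl h) =
          ((dilationWord D.θ (fun j => D.extend (x j)) n * D.proj : D.B) : D.K →L[ℂ] D.K)
            (D.incl h) := by
        simp [proj, adjoint_incl]
      rw [h1, ← mul_apply_eq_comp]
      have h2 : D.projN m * (dilationWord D.θ (fun j => D.extend (x j)) n * D.proj) =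
          dilationWord D.θ (fun j => D.extend (x j)) n * D.proj := by
        rw [← projN_mul_word, ← mul_assoc, projN_mul_of_le _ hm]
      exact congrArg (fun b : D.B => (b : D.K →L[ℂ] D.K) (D.incl h)) h2
    | zero => exact ⟨0, by simp⟩
    | add x y _ _ h1 h2 =>
      obtain ⟨N, hN⟩ := h1
      obtain ⟨M, hM⟩ := h2
      exact ⟨max N M, fun n hn => by
        rw [map_add, hN n (le_trans (le_max_left _ _) hn), hM n (le_trans (le_max_right _ _) hn)]⟩
    | smul c x _ h1 =>
      obtain ⟨N, hN⟩ := h1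
      exact ⟨N, fun n hn => by rw [map_smul, hN n hn]⟩
  rw [Metric.tendsto_atTop]
  intro ε hε
  obtain ⟨k', hk', hd⟩ := Metric.dense_iff.mp D.minimal_space k (ε / 3) (by positivity)
  obtain ⟨N, hN⟩ := hw k' hd
  refine ⟨N, fun n hn => ?_⟩
  have hkk : ‖k' - k‖ < ε / 3 := by simpa [dist_eq_norm] using hk'
  have h1 : (D.projN n : D.K →L[ℂ] D.K) k - k =
      (D.projN n : D.K →L[ℂ] D.K) (k - k') + (k' - k) := by
    rw [map_sub, hN n hn]
    abel
  have h2 : ‖(D.projN n : D.K →L[ℂ] D.K) (k - k')‖ ≤ 1 * ‖k - k'‖ :=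
    ContinuousLinearMap.le_of_opNorm_le _ (D.norm_projN_le n) _
  rw [dist_eq_norm, h1]
  have h3 := norm_add_le ((D.projN n : D.K →L[ℂ] D.K) (k - k')) (k' - k)
  rw [norm_sub_rev k k'] at h2
  linarith

/-- An operator in `B` is determined by its corners `θⁿ(p) b θⁿ(p)`. -/
theorem ext_corner {b c : D.B}
    (h : ∀ n, D.projN (n + 1) * b * D.projN (n + 1) = D.projN (n + 1) * c * D.projN (n + 1)) :
    b = c := by
  have key : ∀ (b : D.B) (k : D.K), Tendsto (fun n =>
      ((D.projN n * b * D.projN n : D.B) : D.K →L[ℂ] D.K) k) atTop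
      (𝓝 ((b : D.K →L[ℂ] D.K) k)) := by
    intro b k
    have h1 : Tendsto (fun n => (b : D.K →L[ℂ] D.K) ((D.projN n : D.K →L[ℂ] D.K) k)) atTop
        (𝓝 ((b : D.K →L[ℂ] D.K) k)) :=
      ((b : D.K →L[ℂ] D.K).continuous.tendsto k).comp (D.tendsto_projN k)
    have h2 := D.tendsto_projN ((b : D.K →L[ℂ] D.K) k)
    rw [tendsto_iff_norm_sub_tendsto_zero] at h1 h2 ⊢
    refine squeeze_zero (fun _ => norm_nonneg _) (fun n => ?_) (by simpa using h1.add h2)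
    have h3 : ((D.projN n * b * D.projN n : D.B) : D.K →L[ℂ] D.K) k - (b : D.K →L[ℂ] D.K) k =
        (D.projN n : D.K →L[ℂ] D.K)
          ((b : D.K →L[ℂ] D.K) ((D.projN n : D.K →L[ℂ] D.K) k) - (b : D.K →L[ℂ] D.K) k) +
        ((D.projN n : D.K →L[ℂ] D.K) ((b : D.K →L[ℂ] D.K) k) - (b : D.K →L[ℂ] D.K) k) := by
      simp
    rw [h3]
    refine (norm_add_le _ _).trans ?_
    gcongr
    simpa using ContinuousLinearMap.le_of_opNorm_le _ (D.norm_projN_le n)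
      ((b : D.K →L[ℂ] D.K) ((D.projN n : D.K →L[ℂ] D.K) k) - (b : D.K →L[ℂ] D.K) k)
  apply Subtype.ext
  ext k
  refine tendsto_nhds_unique ((key b k).comp (tendsto_add_atTop_nat 1)) ?_
  refine ((key c k).comp (tendsto_add_atTop_nat 1)).congr (fun n => ?_)
  simp only [Function.comp]
  rw [h n]

/-- Along a suitable filter, `θⁿ(y) → y` in norm for all `y ∈ P(θ)`. -/
theorem exists_filter_recurrent : ∃ F : Filter ℕ, F.NeBot ∧ F ≤ atTop ∧
    ∀ y ∈ peripheralSubalgebra D.θ, Tendsto (fun n => D.θ^[n] y) F (𝓝 y) := by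
  let g : Circle → Circle := id
  obtain ⟨U, hU, hg⟩ := mapClusterPt_iff_ultrafilter.mp (mapClusterPt_one_atTop_pow g)
  have hpow : ∀ c : ℂ, ‖c‖ = 1 → Tendsto (fun n : ℕ => c ^ n) U (𝓝 1) := by
    intro c hc
    have h1 := (tendsto_pi_nhds.mp hg) (⟨c, by simp [Submonoid.unitSphere, hc]⟩ : Circle)
    have h2 := (continuous_subtype_val.tendsto (1 : Circle)).comp h1
    refine h2.congr (fun n => ?_)
    simp only [Function.comp, g]
    exact Circle.coe_pow _ _
  refine ⟨U, U.neBot, hU, fun y hy => ?_⟩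
  have hspan : ∀ y ∈ Submodule.span ℂ (peripheralEigenvectors (D.θ : D.B →ₗ[ℂ] D.B)),
      Tendsto (fun n => D.θ^[n] y) U (𝓝 y) := by
    intro y hy
    induction hy using Submodule.span_induction with
    | mem y hy =>
      obtain ⟨c, hc, hy⟩ := hy
      have hn : ∀ n : ℕ, D.θ^[n] y = c ^ n • y := by
        intro n
        induction n with
        | zero => simp
        | succ n ih =>
          have hy' : D.θ y = c • y := hy
          rw [Function.iterate_succ_apply', ih, map_smul, hy', smul_smul, pow_succ]
      simp_rw [hn]
      simpa using (hpow c hc).smul_const y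
    | zero =>
      have : ∀ n : ℕ, D.θ^[n] 0 = 0 := fun n => by
        have := D.iterate_smul n 0 0
        rwa [zero_smul, zero_smul] at this
      simp only [this]
      exact tendsto_const_nhds
    | add x y _ _ hx hy =>
      simp_rw [iterate_add]
      exact hx.add hy
    | smul c x _ hx =>
      simp_rw [iterate_smul]
      exact hx.const_smul c
  rw [Metric.tendsto_nhds]
  intro ε hε
  obtain ⟨z, hz, hyz⟩ := Metric.mem_closure_iff.mp (show y ∈ closure _ from hy) (ε / 3)
    (by positivity)
  filter_upwards [Metric.tendsto_nhds.mp (hspan z hz) (ε / 3) (by positivity)] with n hn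
  have h1 : dist (D.θ^[n] y) (D.θ^[n] z) ≤ dist y z := by
    rw [dist_eq_norm, dist_eq_norm, ← iterate_sub]
    exact D.norm_iterate_le n _
  have h2 := dist_triangle4 (D.θ^[n] y) (D.θ^[n] z) z y
  rw [dist_comm z y] at h2
  linarith

/-- Compression is isometric on `P(θ)`. -/
theorem norm_compress (y : D.B) (hy : y ∈ peripheralSubalgebra D.θ) : ‖D.compress y‖ = ‖y‖ := by
  refine le_antisymm (D.norm_compress_le y) ?_
  obtain ⟨F, hF, hFle, hrec⟩ := D.exists_filter_recurrent
  change ‖(y : D.K →L[ℂ] D.K)‖ ≤ _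
  refine ContinuousLinearMap.opNorm_le_bound _ (norm_nonneg _) (fun k => ?_)
  have hT : Tendsto (fun n => ((D.projN n * D.θ^[n] y * D.projN n : D.B) : D.K →L[ℂ] D.K) k) F
      (𝓝 ((y : D.K →L[ℂ] D.K) k)) := by
    have hp : ∀ k, Tendsto (fun n => (D.projN n : D.K →L[ℂ] D.K) k) F (𝓝 k) :=
      fun k => (D.tendsto_projN k).mono_left hFle
    have h0 : Tendsto (fun n => ((D.θ^[n] y : D.B) : D.K →L[ℂ] D.K)) F
        (𝓝 (y : D.K →L[ℂ] D.K)) :=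
      (continuous_subtype_val.tendsto y).comp (hrec y hy)
    have h1 : Tendsto (fun n => ((D.θ^[n] y : D.B) : D.K →L[ℂ] D.K)
        ((D.projN n : D.K →L[ℂ] D.K) k)) F (𝓝 ((y : D.K →L[ℂ] D.K) k)) :=
      (isBoundedBilinearMap_apply (𝕜 := ℂ)).continuous.tendsto (_, _) |>.comp
        (h0.prodMk_nhds (hp k))
    have h2 := hp ((y : D.K →L[ℂ] D.K) k)
    rw [tendsto_iff_norm_sub_tendsto_zero] at h1 h2 ⊢
    refine squeeze_zero (fun _ => norm_nonneg _) (fun n => ?_) (by simpa using h1.add h2)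
    have h3 : ((D.projN n * D.θ^[n] y * D.projN n : D.B) : D.K →L[ℂ] D.K) k
          - (y : D.K →L[ℂ] D.K) k =
        (D.projN n : D.K →L[ℂ] D.K) (((D.θ^[n] y : D.B) : D.K →L[ℂ] D.K)
          ((D.projN n : D.K →L[ℂ] D.K) k) - (y : D.K →L[ℂ] D.K) k) +
        ((D.projN n : D.K →L[ℂ] D.K) ((y : D.K →L[ℂ] D.K) k) - (y : D.K →L[ℂ] D.K) k) := by
      simp
    rw [h3]
    refine (norm_add_le _ _).trans ?_
    gcongr
    simpa using ContinuousLinearMap.le_of_opNorm_le _ (D.norm_projN_le n)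
      (((D.θ^[n] y : D.B) : D.K →L[ℂ] D.K) ((D.projN n : D.K →L[ℂ] D.K) k)
        - (y : D.K →L[ℂ] D.K) k)
  refine le_of_tendsto hT.norm (Eventually.of_forall fun n => ?_)
  have h1 : D.projN n * D.θ^[n] y * D.projN n = D.θ^[n] (D.extend (D.compress y)) := by
    rw [extend_compress, iterate_mul, iterate_mul, projN]
  rw [h1]
  exact ContinuousLinearMap.le_of_opNorm_le _
    ((D.norm_iterate_le n _).trans (D.norm_extend_le _)) k

theorem compress_mem_peripheralSpace (y : D.B) (hy : y ∈ peripheralSubalgebra D.θ) :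
    D.compress y ∈ peripheralSpace τ.toLinearMap := by
  have hcont : Continuous D.compress :=
    AddMonoidHomClass.continuous_of_bound D.compress 1 (by simpa using D.norm_compress_le)
  refine map_mem_closure
    (s := (Submodule.span ℂ (peripheralEigenvectors (D.θ : D.B →ₗ[ℂ] D.B)) : Set D.B))
    (t := (Submodule.span ℂ (peripheralEigenvectors τ.toLinearMap) : Set A))
    hcont hy (fun z hz => ?_)
  induction (show z ∈ Submodule.span ℂ _ from hz) using Submodule.span_induction with
  | mem z hw =>
    obtain ⟨c, hc, hw⟩ := hw
    refine Submodule.subset_span ⟨c, hc, ?_⟩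
    have hw' : D.θ z = c • z := hw
    rw [← map_smul, ← hw', compress_theta]
  | zero => simp
  | add x y hx hy h1 h2 =>
    rw [map_add]
    exact add_mem (h1 hx) (h2 hy)
  | smul c x hx h =>
    rw [map_smul]
    exact Submodule.smul_mem _ _ (h hx)

/-- Peripheral eigenvectors of `τ` lift to peripheral eigenvectors of `θ`. -/
theorem exists_lift (x : A) (c : ℂ) (hc : ‖c‖ = 1) (hx : τ x = c • x) :
    ∃ y : D.B, D.θ y = c • y ∧ D.compress y = x := by
  have hc0 : c ≠ 0 := by
    rintro rfl
    simp at hc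
  let X : ℕ → D.B := fun n => c⁻¹ ^ n • D.θ^[n] (D.extend x)
  have hθX : ∀ n, D.θ (X n) = c • X (n + 1) := by
    intro n
    simp only [X, map_smul]
    rw [Function.iterate_succ_apply', smul_smul, pow_succ, mul_comm, mul_assoc,
      inv_mul_cancel₀ hc0, mul_one]
  have hstep : ∀ n, D.projN n * X (n + 1) * D.projN n = X n := by
    intro n
    have h1 : D.proj * D.θ (D.extend x) * D.proj = c • D.extend x := by
      rw [← extend_compress, compress_theta, compress_extend, hx]
      apply Subtype.ext
      ext k
      simp
    simp only [X]
    rw [mul_smul_comm, smul_mul_assoc, Function.iterate_succ_apply, projN, ← iterate_mul,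
      ← iterate_mul, h1, iterate_smul, smul_smul, pow_succ, mul_assoc, inv_mul_cancel₀ hc0, mul_one]
  have hmart : ∀ m n, m ≤ n → D.projN m * X n * D.projN m = X m := by
    intro m n h
    induction n, h using Nat.le_induction with
    | base =>
      simp only [X]
      rw [mul_smul_comm, smul_mul_assoc, projN, ← iterate_mul, ← iterate_mul, proj, extend_mul,
        extend_mul, one_mul, mul_one]
    | succ n h ih =>
      rw [← ih, ← hstep n]
      calc _ = (D.projN m * D.projN n) * X (n + 1) * (D.projN n * D.projN m) := by
            rw [mul_projN_of_le _ h, projN_mul_of_le _ h]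
        _ = _ := by noncomm_ring
  have hXn : ∀ n, ‖X n‖ ≤ ‖x‖ := by
    intro n
    simp only [X]
    rw [norm_smul, norm_pow, norm_inv, hc, inv_one, one_pow, one_mul]
    exact (D.norm_iterate_le n _).trans (D.norm_extend_le x)
  have hcau : ∀ k : D.K, CauchySeq (fun n => (X n : D.K →L[ℂ] D.K) k) := by
    have hcorner : ∀ (m : ℕ) (k : D.K), CauchySeq (fun n =>
        (X n : D.K →L[ℂ] D.K) ((D.projN m : D.K →L[ℂ] D.K) k)) := by
      intro m k
      set v : ℕ → D.K := fun n => (X n : D.K →L[ℂ] D.K) ((D.projN m : D.K →L[ℂ] D.K) k) with hv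
      have hpv : ∀ l n, m ≤ l → l ≤ n → (D.projN l : D.K →L[ℂ] D.K) (v n) = v l := by
        intro l n hl hn
        have h1 : D.projN l * (X n * D.projN m) = X l * D.projN m := by
          rw [← hmart l n hn, mul_assoc (D.projN l * X n), projN_mul_of_le _ hl, mul_assoc]
        exact congrArg (fun t : D.B => (t : D.K →L[ℂ] D.K) k) h1
      have hsq : ∀ l n, m ≤ l → l ≤ n → ‖v n - v l‖ ^ 2 = ‖v n‖ ^ 2 - ‖v l‖ ^ 2 := by
        intro l n hl hn
        have hadj : (D.projN l : D.K →L[ℂ] D.K).adjoint = D.projN l :=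
          congrArg Subtype.val (D.star_projN l)
        have h1 : inner ℂ (v n) (v l) = inner ℂ (v l) (v l) := by
          calc inner ℂ (v n) (v l) = inner ℂ (v n) ((D.projN l : D.K →L[ℂ] D.K) (v l)) := by
                rw [hpv l l hl le_rfl]
            _ = inner ℂ ((D.projN l : D.K →L[ℂ] D.K).adjoint (v n)) (v l) :=
                (ContinuousLinearMap.adjoint_inner_left _ _ _).symm
            _ = _ := by rw [hadj, hpv l n hl hn]
        rw [@norm_sub_sq ℂ, h1, inner_self_eq_norm_sq]
        ring
      have hmono : Monotone (fun j => ‖v (m + j)‖ ^ 2) := by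
        refine monotone_nat_of_le_succ fun j => ?_
        have := hsq (m + j) (m + (j + 1)) (by omega) (by omega)
        nlinarith [sq_nonneg ‖v (m + (j + 1)) - v (m + j)‖]
      have hbdd : BddAbove (Set.range (fun j => ‖v (m + j)‖ ^ 2)) := by
        refine ⟨(‖x‖ * ‖(D.projN m : D.K →L[ℂ] D.K) k‖) ^ 2, ?_⟩
        rintro _ ⟨j, rfl⟩
        change ‖v (m + j)‖ ^ 2 ≤ _
        gcongr
        exact ContinuousLinearMap.le_of_opNorm_le _ (hXn _) _
      have hC := (tendsto_atTop_ciSup hmono hbdd).cauchySeq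
      rw [Metric.cauchySeq_iff'] at hC ⊢
      intro ε hε
      obtain ⟨N, hN⟩ := hC (ε ^ 2) (by positivity)
      refine ⟨m + N, fun n hn => ?_⟩
      obtain ⟨j, rfl⟩ := Nat.exists_eq_add_of_le (show m ≤ n by omega)
      have h1 := hN j (by omega)
      have h2 := hsq (m + N) (m + j) (by omega) hn
      rw [Real.dist_eq] at h1
      rw [dist_eq_norm]
      refine lt_of_pow_lt_pow_left₀ 2 hε.le ?_
      change ‖v (m + j) - v (m + N)‖ ^ 2 < _
      rw [h2]
      exact (le_abs_self _).trans_lt h1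
    intro k
    rw [Metric.cauchySeq_iff]
    intro ε hε
    have hx1 : 0 < ‖x‖ + 1 := by positivity
    obtain ⟨m, hm⟩ := ((Metric.tendsto_nhds.mp (D.tendsto_projN k)) (ε / (3 * (‖x‖ + 1)))
      (by positivity)).exists
    obtain ⟨N, hN⟩ := Metric.cauchySeq_iff.mp (hcorner m k) (ε / 3) (by positivity)
    refine ⟨N, fun a ha b hb => ?_⟩
    have hd : ∀ n, dist ((X n : D.K →L[ℂ] D.K) k)
        ((X n : D.K →L[ℂ] D.K) ((D.projN m : D.K →L[ℂ] D.K) k)) < ε / 3 := by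
      intro n
      rw [dist_eq_norm, ← map_sub]
      refine (ContinuousLinearMap.le_of_opNorm_le _ (hXn n) _).trans_lt ?_
      rw [← dist_eq_norm, dist_comm]
      calc ‖x‖ * dist ((D.projN m : D.K →L[ℂ] D.K) k) k
          ≤ (‖x‖ + 1) * dist ((D.projN m : D.K →L[ℂ] D.K) k) k := by gcongr; linarith
        _ < (‖x‖ + 1) * (ε / (3 * (‖x‖ + 1))) := by gcongr
        _ = ε / 3 := by field_simp
    have h3 := dist_triangle4 ((X a : D.K →L[ℂ] D.K) k)
      ((X a : D.K →L[ℂ] D.K) ((D.projN m : D.K →L[ℂ] D.K) k))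
      ((X b : D.K →L[ℂ] D.K) ((D.projN m : D.K →L[ℂ] D.K) k)) ((X b : D.K →L[ℂ] D.K) k)
    have h4 := hd a
    have h5 := hd b
    have h6 := hN a ha b hb
    rw [dist_comm] at h5
    linarith
  choose f hf using fun k => cauchySeq_tendsto_of_complete (hcau k)
  let Y : D.K →L[ℂ] D.K := continuousLinearMapOfTendsto
    (fun n => (X n : D.K →L[ℂ] D.K)) (f := f) (l := atTop) (tendsto_pi_nhds.mpr hf)
  have hY : ∀ k, Tendsto (fun n => (X n : D.K →L[ℂ] D.K) k) atTop (𝓝 (Y k)) := hf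
  have hYB : Y ∈ D.B := by
    rw [← SetLike.mem_coe, ← D.B.centralizer_centralizer]
    intro z hz
    ext k
    have h1 := hY (z k)
    have h2 := (z.continuous.tendsto _).comp (hY k)
    refine tendsto_nhds_unique h2 (h1.congr fun n => ?_)
    exact (congrArg (fun t : D.K →L[ℂ] D.K => t k) (hz _ (X n).2))
  let y : D.B := ⟨Y, hYB⟩
  have hy : ∀ m, D.projN m * y * D.projN m = X m := by
    intro m
    apply Subtype.ext
    ext k
    have h1 := ((D.projN m : D.K →L[ℂ] D.K).continuous.tendsto _).comp
      (hY ((D.projN m : D.K →L[ℂ] D.K) k))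
    refine tendsto_nhds_unique h1 ?_
    refine tendsto_const_nhds.congr' ?_
    filter_upwards [eventually_ge_atTop m] with n hn
    exact (congrArg (fun t : D.B => (t : D.K →L[ℂ] D.K) k) (hmart m n hn)).symm
  refine ⟨y, D.ext_corner fun n => ?_, D.extend_inj ?_⟩
  · have h1 : D.projN (n + 1) = D.θ (D.projN n) := Function.iterate_succ_apply' _ _ _
    rw [mul_smul_comm, smul_mul_assoc, hy, ← hθX, h1, ← map_mul, ← map_mul, hy]
  · rw [extend_compress]
    have := hy 0
    simpa [projN, X] using this

theorem compress_surjective (x : A) (hx : x ∈ peripheralSpace τ.toLinearMap) :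
    ∃ y ∈ peripheralSubalgebra D.θ, D.compress y = x := by
  have hcont : Continuous D.compress :=
    AddMonoidHomClass.continuous_of_bound D.compress 1 (by simpa using D.norm_compress_le)
  let T : peripheralSubalgebra D.θ → A := fun y => D.compress y
  have hT : Isometry T := by
    refine Isometry.of_dist_eq fun y z => ?_
    rw [dist_eq_norm, dist_eq_norm]
    change ‖D.compress y - D.compress z‖ = ‖((y - z : peripheralSubalgebra D.θ) : D.B)‖
    rw [← map_sub]
    exact D.norm_compress _ (y - z).2
  have hcl : IsClosed (Set.range T) := hT.isClosedEmbedding.isClosed_range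
  have hsub : (Submodule.span ℂ (peripheralEigenvectors τ.toLinearMap) : Set A) ⊆
      Set.range T := by
    intro x hx
    induction (show x ∈ Submodule.span ℂ _ from hx) using Submodule.span_induction with
    | mem x hw =>
      obtain ⟨c, hc, hw⟩ := hw
      obtain ⟨y, hy, hyx⟩ := D.exists_lift x c hc hw
      exact ⟨⟨y, Submodule.le_topologicalClosure _ (Submodule.subset_span ⟨c, hc, hy⟩)⟩, hyx⟩
    | zero => exact ⟨0, map_zero D.compress⟩
    | add x y hx' hy' h1 h2 =>
      obtain ⟨a, ha⟩ := h1 hx'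
      obtain ⟨b, hb⟩ := h2 hy'
      exact ⟨a + b, by rw [← ha, ← hb]; exact map_add D.compress _ _⟩
    | smul c x hx' h =>
      obtain ⟨a, ha⟩ := h hx'
      exact ⟨c • a, by rw [← ha]; exact map_smul D.compress _ _⟩
  obtain ⟨y, hy⟩ := closure_minimal hsub hcl hx
  exact ⟨y, y.2, hy⟩

/-! ### The peripheral Poisson boundary -/

/-- The peripheral Poisson boundary of `τ`: the space `P(τ) ⊆ A`, the norm-closed linear span
of the peripheral eigenvectors of `τ`, with the norm of `A`. The product below is defined
through the minimal dilation `D`. -/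
noncomputable abbrev boundarySpace (_D : MinimalDilation τ) : Submodule ℂ A := peripheralSpace τ.toLinearMap

/-- See `boundarySpace`. -/
noncomputable def Boundary : Type u := D.boundarySpace

namespace Boundary

noncomputable instance : NormedAddCommGroup D.Boundary :=
  inferInstanceAs (NormedAddCommGroup D.boundarySpace)

noncomputable instance : NormedSpace ℂ D.Boundary :=
  inferInstanceAs (NormedSpace ℂ D.boundarySpace)

instance : CompleteSpace D.Boundary :=
  (Submodule.isClosed_topologicalClosure
    (Submodule.span ℂ (peripheralEigenvectors τ.toLinearMap))).completeSpace_coe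

/-- The inclusion `P(τ) ⊆ A`. -/
instance : CoeOut D.Boundary A := ⟨Subtype.val⟩

end Boundary

/-- The compression map `T : P(θ) → P(τ)`, `T z = pzp`, an isometric linear bijection. -/
noncomputable def compressEquiv : peripheralSubalgebra D.θ ≃ₗᵢ[ℂ] D.Boundary :=
  LinearIsometryEquiv.ofSurjective
    { toFun := fun y => ⟨D.compress y, D.compress_mem_peripheralSpace y y.2⟩
      map_add' := fun _ _ => Subtype.ext (map_add D.compress _ _)
      map_smul' := fun _ _ => Subtype.ext (map_smul D.compress _ _)
      norm_map' := fun y => D.norm_compress y y.2 }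
    (fun x => by
      obtain ⟨y, hy, hyx⟩ := D.compress_surjective x.1 x.2
      exact ⟨⟨y, hy⟩, Subtype.ext hyx⟩)

theorem coe_compressEquiv (y : peripheralSubalgebra D.θ) :
    ((D.compressEquiv y : D.Boundary) : A) = D.compress y := rfl

namespace Boundary

/-- The product `x ∘ y = T(T⁻¹(x) T⁻¹(y))`. -/
noncomputable instance : Mul D.Boundary :=
  ⟨fun x y => D.compressEquiv (D.compressEquiv.symm x * D.compressEquiv.symm y)⟩

/-- The unit is the unit of `A`. -/
noncomputable instance : One D.Boundary := ⟨⟨1, Submodule.le_topologicalClosure _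
  (Submodule.subset_span ⟨1, by simp, by simpa using τ.map_one⟩)⟩⟩

theorem star_mem_boundarySpace (x : D.Boundary) : star (x : A) ∈ D.boundarySpace := by
  obtain ⟨y, hy, hyx⟩ := D.compress_surjective x.1 x.2
  rw [← hyx, ← compress_star]
  exact D.compress_mem_peripheralSpace _ (star_mem hy)

/-- The involution is that of `A`. -/
noncomputable instance : Star D.Boundary := ⟨fun x => ⟨star (x : A), star_mem_boundarySpace D x⟩⟩

theorem mul_def (x y : D.Boundary) :
    x * y = D.compressEquiv (D.compressEquiv.symm x * D.compressEquiv.symm y) := rfl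

theorem symm_mul (x y : D.Boundary) :
    D.compressEquiv.symm (x * y) = D.compressEquiv.symm x * D.compressEquiv.symm y := by
  rw [mul_def, LinearIsometryEquiv.symm_apply_apply]

theorem symm_one : D.compressEquiv.symm 1 = 1 := by
  rw [LinearIsometryEquiv.symm_apply_eq]
  exact Subtype.ext D.compress_one.symm

theorem symm_star (x : D.Boundary) :
    D.compressEquiv.symm (star x) = star (D.compressEquiv.symm x) := by
  rw [LinearIsometryEquiv.symm_apply_eq]
  apply Subtype.ext
  change star (x : A) = D.compress (star (D.compressEquiv.symm x : D.B))
  rw [compress_star, ← coe_compressEquiv, LinearIsometryEquiv.apply_symm_apply]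

noncomputable instance : Ring D.Boundary :=
  { (inferInstance : AddCommGroup D.Boundary) with
    mul := (· * ·)
    one := 1
    mul_assoc := fun a b c => D.compressEquiv.symm.injective (by simp only [symm_mul, mul_assoc])
    one_mul := fun a => D.compressEquiv.symm.injective (by
      simp only [symm_mul, symm_one, one_mul])
    mul_one := fun a => D.compressEquiv.symm.injective (by
      simp only [symm_mul, symm_one, mul_one])
    zero_mul := fun a => D.compressEquiv.symm.injective (by
      simp only [symm_mul, map_zero, zero_mul])
    mul_zero := fun a => D.compressEquiv.symm.injective (by
      simp only [symm_mul, map_zero, mul_zero])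
    left_distrib := fun a b c => D.compressEquiv.symm.injective (by
      simp only [symm_mul, map_add, mul_add])
    right_distrib := fun a b c => D.compressEquiv.symm.injective (by
      simp only [symm_mul, map_add, add_mul]) }

noncomputable instance : StarRing D.Boundary where
  star_involutive a := Subtype.ext (star_star (a : A))
  star_mul a b := D.compressEquiv.symm.injective (by simp only [symm_mul, symm_star, star_mul])
  star_add a b := Subtype.ext (star_add (a : A) (b : A))

noncomputable instance : NormedRing D.Boundary :=
  { (inferInstance : Ring D.Boundary), (inferInstance : NormedAddCommGroup D.Boundary) with
    norm_mul_le := fun a b => by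
      have h := norm_mul_le (D.compressEquiv.symm a) (D.compressEquiv.symm b)
      rwa [← symm_mul, LinearIsometryEquiv.norm_map, LinearIsometryEquiv.norm_map,
        LinearIsometryEquiv.norm_map] at h }

noncomputable instance : Algebra ℂ D.Boundary :=
  Algebra.ofModule
    (fun c a b => D.compressEquiv.symm.injective (by
      simp only [symm_mul, map_smul, smul_mul_assoc]))
    (fun c a b => D.compressEquiv.symm.injective (by
      simp only [symm_mul, map_smul, mul_smul_comm]))

noncomputable instance : NormedAlgebra ℂ D.Boundary where
  norm_smul_le := fun c a => (norm_smul c a).le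

instance : StarModule ℂ D.Boundary where
  star_smul c a := Subtype.ext (star_smul c (a : A))

instance : CStarRing D.Boundary where
  norm_mul_self_le a := by
    have h := CStarRing.norm_mul_self_le (D.compressEquiv.symm a)
    rwa [← symm_star, ← symm_mul, LinearIsometryEquiv.norm_map,
      LinearIsometryEquiv.norm_map] at h

/-- `(P(τ), ∘)` is a unital C*-algebra. -/
noncomputable instance : CStarAlgebra D.Boundary where

end Boundary

end MinimalDilation

/-! Automorphism. Compression satisfies `T ∘ θ = τ ∘ T`, so the *-isomorphism `T : P(θ) → (P(τ), ∘)`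
carries the restriction of `θ` to that of `τ`, and it suffices that `θ` restricts to an automorphism
of `P(θ)`. The restriction is isometric: along a suitable filter `θⁿ(y)` returns to `y` in norm
(`exists_filter_recurrent`), while `‖θⁿ(y)‖ ≤ ‖θ(y)‖` for `n ≥ 1`. It is onto: its range is closed
and contains every eigenvector `y = θ(c⁻¹y)`. Every peripheral eigenvector of `τ` is one of the
automorphism, and these span a norm-dense subspace of `P(τ)`.

Existence. Complete positivity makes `chain` a positive definite kernel on words
(`isPositiveKernel_chain`). Its Kolmogorov space `K` is spanned by vectors `w [x₁, …, xₙ] h`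
standing for `θⁿ(xₙ) ⋯ θ(x₁) h`, and unitality makes padding a word by `1` harmless. In module
language `K = 𝓔 ⊗_A H` with `𝓔` spanned by words, but also `K = 𝓔 ⊗_A L` with `L = A ⊗_τ H` the
Stinespring space. The endomorphism is `b ↦ b ⊗ 1_L`, defined on the commutant of the natural action
of `A'` on `K`.

To define `b ⊗ 1_L` without modules, `L` is exhausted by the ranges of `A`-intertwiners `T : H → L`
(`dense_span_intertwiner`); normality of `τ` is needed here. Each `T` gives an operator `1 ⊗ T` on
`K` (`shift`), and the rule is `θ(b) (1 ⊗ T) k = (1 ⊗ T) b k`. It is consistent because `(1 ⊗ T)* (1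
⊗ S)` is the action of `T* S ∈ A'`, which commutes with `b`. Then `θⁿ(a)` multiplies the last letter
of a word of length `n ≥ 1` by `a`, which yields the dilation property and minimality. A commutant
computation shows that `θ` preserves the algebra generated by all `θⁿ(a)`. -/

/-! ### Bounded operators prescribed on total families -/

section HilbertExtension

variable {X K K' : Type*} [NormedAddCommGroup K] [InnerProductSpace ℂ K]
  [NormedAddCommGroup K'] [InnerProductSpace ℂ K']

theorem denseRange_linearCombination {f : X → K}
    (hf : Dense (Submodule.span ℂ (Set.range f) : Set K)) :
    DenseRange (Finsupp.linearCombination ℂ f) := by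
  rwa [← Finsupp.range_linearCombination] at hf

theorem eq_of_inner_total {f : X → K} (hf : Dense (Submodule.span ℂ (Set.range f) : Set K))
    {u v : K} (h : ∀ x, inner ℂ (f x) u = inner ℂ (f x) v) : u = v := by
  refine (denseRange_linearCombination hf).eq_of_inner_right ℂ fun m => ?_
  simp [Finsupp.linearCombination_apply, Finsupp.sum_inner, inner_smul_left, h]

theorem clm_eq_of_total {F : Type*} [NormedAddCommGroup F] [NormedSpace ℂ F] {f : X → K}
    (hf : Dense (Submodule.span ℂ (Set.range f) : Set K))
    {S T : K →L[ℂ] F} (h : ∀ x, S (f x) = T (f x)) : S = T :=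
  ContinuousLinearMap.ext_on hf (by rintro _ ⟨x, rfl⟩; exact h x)

/-- The `f x` may be linearly dependent; the bound on all linear combinations gives well-definedness
and continuity at once. -/
theorem exists_clm_of_norm_le [CompleteSpace K'] {f : X → K} {g : X → K'}
    (hf : Dense (Submodule.span ℂ (Set.range f) : Set K)) (C : ℝ)
    (h : ∀ m, ‖Finsupp.linearCombination ℂ g m‖ ≤ C * ‖Finsupp.linearCombination ℂ f m‖) :
    ∃ T : K →L[ℂ] K', ∀ x, T (f x) = g x := by
  refine ⟨(Finsupp.linearCombination ℂ g).extendOfNorm (Finsupp.linearCombination ℂ f),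
    fun x => ?_⟩
  have := LinearMap.extendOfNorm_eq (denseRange_linearCombination hf) ⟨C, h⟩ (Finsupp.single x 1)
  simpa using this

/-- A family `g` whose Gram kernel is `⟨f x, R (f y)⟩` for a bounded operator `R` is the image of
the total family `f` under a bounded operator. -/
theorem exists_clm_of_inner_eq [CompleteSpace K'] {f : X → K} {g : X → K'}
    (hf : Dense (Submodule.span ℂ (Set.range f) : Set K)) (R : K →L[ℂ] K)
    (h : ∀ x y, inner ℂ (g x) (g y) = inner ℂ (f x) (R (f y))) :
    ∃ T : K →L[ℂ] K', ∀ x, T (f x) = g x := by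
  refine exists_clm_of_norm_le hf (Real.sqrt ‖R‖) fun m => ?_
  have h1 : ∀ m m', inner ℂ (Finsupp.linearCombination ℂ g m) (Finsupp.linearCombination ℂ g m') =
      inner ℂ (Finsupp.linearCombination ℂ f m) (R (Finsupp.linearCombination ℂ f m')) := by
    intro m m'
    simp only [Finsupp.linearCombination_apply, map_finsuppSum, map_smul, Finsupp.sum_inner,
      Finsupp.inner_sum, inner_smul_left, inner_smul_right, h]
  refine le_of_sq_le_sq ?_ (by positivity)
  rw [mul_pow, Real.sq_sqrt (norm_nonneg _), ← inner_self_eq_norm_sq (𝕜 := ℂ), h1]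
  set v := Finsupp.linearCombination ℂ f m
  calc _ ≤ ‖v‖ * ‖R v‖ := re_inner_le_norm _ _
    _ ≤ ‖v‖ * (‖R‖ * ‖v‖) := by gcongr; exact R.le_opNorm v
    _ = _ := by ring

end HilbertExtension

/-! ### Representations of C*-algebras from invariant Gram kernels -/

section KernelRepresentation

variable {𝓑 : Type*} [CStarAlgebra 𝓑] [PartialOrder 𝓑] [StarOrderedRing 𝓑]
  {X K : Type*} [NormedAddCommGroup K] [InnerProductSpace ℂ K] [CompleteSpace K]

/-- A family of vectors `g b x`, linear in `b`, with `⟨g b x, g c y⟩ = ⟨g 1 x, g (b* c) y⟩` defines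
a representation of the C*-algebra on the closed span of the vectors `g 1 x`. -/
theorem exists_starAlgHom_of_inner_eq (g : 𝓑 →ₗ[ℂ] (X → K))
    (htot : Dense (Submodule.span ℂ (Set.range (g 1)) : Set K))
    (hg : ∀ b c x y, inner ℂ (g b x) (g c y) = inner ℂ (g 1 x) (g (star b * c) y)) :
    ∃ Θ : 𝓑 →⋆ₐ[ℂ] (K →L[ℂ] K), ∀ b x, Θ b (g 1 x) = g b x := by
  have hG : ∀ b c m m', inner ℂ (Finsupp.linearCombination ℂ (g b) m)
      (Finsupp.linearCombination ℂ (g c) m') = inner ℂ (Finsupp.linearCombination ℂ (g 1) m)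
      (Finsupp.linearCombination ℂ (g (star b * c)) m') := by
    intro b c m m'
    simp only [Finsupp.linearCombination_apply, Finsupp.sum_inner, Finsupp.inner_sum,
      inner_smul_left, inner_smul_right]
    simp only [hg b c]
  have hbound : ∀ b m, ‖Finsupp.linearCombination ℂ (g b) m‖ ≤
      ‖b‖ * ‖Finsupp.linearCombination ℂ (g 1) m‖ := by
    intro b m
    -- Writing `‖b‖² - b* b = c* c` turns `‖g c m‖² ≥ 0` into the desired bound, where `g b m`
    -- abbreviates the combination of the vectors `g b x` with coefficients `m`.
    have h0 : 0 ≤ algebraMap ℝ 𝓑 (‖b‖ ^ 2) - star b * b :=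
      sub_nonneg.mpr CStarAlgebra.star_mul_le_algebraMap_norm_sq
    obtain ⟨c, hc⟩ := CStarAlgebra.nonneg_iff_eq_star_mul_self.mp h0
    have h1 : Finsupp.linearCombination ℂ (g (star c * c)) m =
        ((‖b‖ ^ 2 : ℝ) : ℂ) • Finsupp.linearCombination ℂ (g 1) m -
          Finsupp.linearCombination ℂ (g (star b * b)) m := by
      have h2 : algebraMap ℝ 𝓑 (‖b‖ ^ 2) = ((‖b‖ ^ 2 : ℝ) : ℂ) • (1 : 𝓑) := by
        rw [Algebra.algebraMap_eq_smul_one]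
        exact (RCLike.real_smul_eq_coe_smul (K := ℂ) _ _)
      rw [← hc, h2, map_sub, map_smul]
      simp only [Finsupp.linearCombination_apply, Pi.sub_apply, Pi.smul_apply, smul_sub,
        Finsupp.sum_sub, Finsupp.smul_sum]
      congr 1
      exact Finsupp.sum_congr fun x _ => smul_comm _ _ _
    have h3 : ‖Finsupp.linearCombination ℂ (g c) m‖ ^ 2 =
        ‖b‖ ^ 2 * ‖Finsupp.linearCombination ℂ (g 1) m‖ ^ 2 -
          ‖Finsupp.linearCombination ℂ (g b) m‖ ^ 2 := by
      rw [← inner_self_eq_norm_sq (𝕜 := ℂ), hG, h1, inner_sub_right, inner_smul_right, ← hG,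
        map_sub, inner_self_eq_norm_sq (𝕜 := ℂ)]
      congr 1
      exact (Complex.re_ofReal_mul _ _).trans
        (congrArg (‖b‖ ^ 2 * ·) (inner_self_eq_norm_sq (𝕜 := ℂ) _))
    refine le_of_sq_le_sq ?_ (by positivity)
    rw [mul_pow]
    nlinarith [sq_nonneg ‖Finsupp.linearCombination ℂ (g c) m‖]
  choose Θ hΘ using fun b => exists_clm_of_norm_le htot ‖b‖ (hbound b)
  have hadj : ∀ b, star (Θ b) = Θ (star b) := by
    intro b
    refine clm_eq_of_total htot fun x => eq_of_inner_total htot fun y => ?_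
    rw [ContinuousLinearMap.star_eq_adjoint, ContinuousLinearMap.adjoint_inner_right, hΘ, hΘ, hg,
      mul_one]
  refine ⟨{ toFun := Θ, map_one' := ?_, map_mul' := ?_, map_zero' := ?_, map_add' := ?_,
            commutes' := ?_, map_star' := fun b => (hadj b).symm }, hΘ⟩
  · exact clm_eq_of_total htot fun x => by rw [hΘ]; rfl
  -- `Θ b` is prescribed only on the vectors `g 1 x`, not on `g c x`, so its adjoint is moved to the
  -- other side of the inner product.
  · intro b c
    refine clm_eq_of_total htot fun x => eq_of_inner_total htot fun y => ?_
    change _ = inner ℂ _ (Θ b (Θ c (g 1 x)))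
    rw [hΘ, hΘ, ← ContinuousLinearMap.adjoint_inner_left, ← ContinuousLinearMap.star_eq_adjoint,
      hadj, hΘ, hg (star b), star_star]
  · exact clm_eq_of_total htot fun x => by rw [hΘ]; simp
  · intro b c
    exact clm_eq_of_total htot fun x => by simp [hΘ]
  · intro r
    refine clm_eq_of_total htot fun x => ?_
    rw [hΘ, Algebra.algebraMap_eq_smul_one, Algebra.algebraMap_eq_smul_one, map_smul]
    simp

end KernelRepresentation

/-! ### Strong convergence of bounded increasing nets -/

section StrongConvergence

variable {H : Type*} [NormedAddCommGroup H] [InnerProductSpace ℂ H]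

theorem clm_nonneg_iff (q : H →L[ℂ] H) :
    0 ≤ q ↔ ∀ k, (inner ℂ (q k) k).im = 0 ∧ 0 ≤ (inner ℂ (q k) k).re := by
  rw [ContinuousLinearMap.nonneg_iff_isPositive, ContinuousLinearMap.isPositive_iff_complex]
  refine forall_congr' fun k => and_congr_left fun _ => ?_
  simp [Complex.ext_iff, eq_comm]

/-- For `q = c* c` this is the square of `‖c* (c k)‖ ≤ ‖c‖ ‖c k‖`. It turns convergence of the
quadratic forms into strong convergence. -/
theorem norm_sq_apply_le_of_nonneg [CompleteSpace H] {q : H →L[ℂ] H} (hq : 0 ≤ q) (k : H) :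
    ‖q k‖ ^ 2 ≤ ‖q‖ * (inner ℂ (q k) k).re := by
  obtain ⟨c, rfl⟩ := CStarAlgebra.nonneg_iff_eq_star_mul_self.mp hq
  have h1 : (inner ℂ ((star c * c) k) k).re = ‖c k‖ ^ 2 := by
    change (inner ℂ ((star c) (c k)) k).re = _
    rw [ContinuousLinearMap.star_eq_adjoint, ContinuousLinearMap.adjoint_inner_left]
    exact inner_self_eq_norm_sq (𝕜 := ℂ) _
  rw [h1, CStarRing.norm_star_mul_self]
  have h2 : ‖(star c * c) k‖ ≤ ‖c‖ * ‖c k‖ := by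
    simpa using (star c).le_opNorm (c k)
  calc _ ≤ (‖c‖ * ‖c k‖) ^ 2 := by gcongr
    _ = _ := by ring

theorem re_inner_apply_le [CompleteSpace H] {s t : H →L[ℂ] H} (h : s ≤ t) (k : H) :
    (inner ℂ (s k) k).re ≤ (inner ℂ (t k) k).re := by
  have := ((clm_nonneg_iff _).mp (sub_nonneg.mpr h) k).2
  simpa [inner_sub_left] using this

theorem le_of_tendsto_apply [CompleteSpace H] {ι : Type*} {l : Filter ι} [l.NeBot] {s t : ι → H →L[ℂ] H}
    {x y : H →L[ℂ] H} (hs : ∀ k, Tendsto (fun i => s i k) l (𝓝 (x k)))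
    (ht : ∀ k, Tendsto (fun i => t i k) l (𝓝 (y k))) (h : ∀ᶠ i in l, s i ≤ t i) : x ≤ y := by
  rw [← sub_nonneg, clm_nonneg_iff]
  intro k
  have h1 : Tendsto (fun i => inner ℂ ((t i - s i) k) k) l (𝓝 (inner ℂ ((y - x) k) k)) :=
    ((ht k).sub (hs k)).inner tendsto_const_nhds
  refine ⟨?_, ?_⟩
  · refine tendsto_nhds_unique ((Complex.continuous_im.tendsto _).comp h1) ?_
    refine tendsto_const_nhds.congr' ?_
    filter_upwards [h] with i hi
    exact (((clm_nonneg_iff _).mp (sub_nonneg.mpr hi) k).1).symm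
  · refine ge_of_tendsto ((Complex.continuous_re.tendsto _).comp h1) ?_
    filter_upwards [h] with i hi
    exact ((clm_nonneg_iff _).mp (sub_nonneg.mpr hi) k).2

/-- A bounded increasing net of operators converges strongly. -/
theorem exists_strong_limit [CompleteSpace H] {ι : Type*} [Preorder ι] [IsDirectedOrder ι] [Nonempty ι]
    (s : ι → H →L[ℂ] H) (hs : Monotone s) (x : H →L[ℂ] H) (hx : ∀ i, s i ≤ x) :
    ∃ y : H →L[ℂ] H, ∀ k, Tendsto (fun i => s i k) atTop (𝓝 (y k)) := by
  let i₀ : ι := Classical.arbitrary ι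
  set C := ‖x - s i₀‖ with hC
  have hdiff : ∀ i j, i₀ ≤ i → i ≤ j → ‖s j - s i‖ ≤ C := fun i j h0 hij =>
    CStarAlgebra.norm_le_norm_of_nonneg_of_le (sub_nonneg.mpr (hs hij))
      (sub_le_sub (hx j) (hs h0))
  have hcau : ∀ k, CauchySeq (fun i => s i k) := by
    intro k
    set r : ι → ℝ := fun i => (inner ℂ (s i k) k).re with hr
    have hbdd : BddAbove (Set.range r) :=
      ⟨(inner ℂ (x k) k).re, by rintro _ ⟨i, rfl⟩; exact re_inner_apply_le (hx i) k⟩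
    refine Metric.cauchy_iff.mpr ⟨inferInstance, fun ε hε => ?_⟩
    have hC0 : 0 < C + 1 := by positivity
    -- The tolerance is chosen so that `‖(s i - s N) k‖² ≤ (C + 1) (r i - r N) < (ε / 2)²`; using `C
    -- + 1` avoids a division by zero.
    obtain ⟨N₀, hN₀⟩ := exists_lt_of_lt_ciSup
      (show (⨆ i, r i) - (ε / 2) ^ 2 / (C + 1) < ⨆ i, r i by
        have : 0 < (ε / 2) ^ 2 / (C + 1) := by positivity
        linarith)
    obtain ⟨N, hN0, hN1⟩ := exists_ge_ge i₀ N₀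
    have key : ∀ i, N ≤ i → dist (s i k) (s N k) < ε / 2 := by
      intro i hi
      rw [dist_eq_norm]
      refine lt_of_pow_lt_pow_left₀ 2 (by positivity) ?_
      have h1 := norm_sq_apply_le_of_nonneg (sub_nonneg.mpr (hs hi)) k
      have h2 : (inner ℂ ((s i - s N) k) k).re = r i - r N := by
        simp [hr]
      have h3 : r i ≤ ⨆ i, r i := le_ciSup hbdd i
      have h4 : r N₀ ≤ r N := re_inner_apply_le (hs hN1) k
      have h5 : r N ≤ r i := re_inner_apply_le (hs hi) k
      rw [h2] at h1
      have h6 : r i - r N < (ε / 2) ^ 2 / (C + 1) := by linarith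
      rw [lt_div_iff₀ hC0] at h6
      calc ‖s i k - s N k‖ ^ 2 ≤ ‖s i - s N‖ * (r i - r N) := h1
        _ ≤ (C + 1) * (r i - r N) := by
          gcongr
          linarith [hdiff N i hN0 hi]
        _ < _ := by linarith
    refine ⟨(fun i => s i k) '' Set.Ici N, image_mem_map (Ici_mem_atTop N), ?_⟩
    rintro _ ⟨i, hi, rfl⟩ _ ⟨j, hj, rfl⟩
    have h1 := key i hi
    have h2 := key j hj
    have h3 := dist_triangle_right (s i k) (s j k) (s N k)
    linarith
  choose f hf using fun k => cauchySeq_tendsto_of_complete (hcau k)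
  let L : H →ₗ[ℂ] H := linearMapOfTendsto f (fun i => (s i : H →ₗ[ℂ] H)) (tendsto_pi_nhds.mpr hf)
  refine ⟨L.mkContinuous (C + ‖s i₀‖) fun k => ?_, hf⟩
  refine le_of_tendsto (hf k).norm ?_
  filter_upwards [eventually_ge_atTop i₀] with i hi
  refine ContinuousLinearMap.le_of_opNorm_le _ ?_ k
  have h1 := hdiff i₀ i le_rfl hi
  have h2 := norm_le_norm_sub_add (s i) (s i₀)
  linarith

end StrongConvergence

/-! ### Suprema and normal functionals on a von Neumann algebra -/

namespace VonNeumannAlgebra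

variable {H : Type u} [NormedAddCommGroup H] [InnerProductSpace ℂ H] [CompleteSpace H]

/-- The algebra is a commutant, and commuting with a fixed operator passes to strong limits. -/
theorem mem_of_tendsto_apply (A : VonNeumannAlgebra H) {ι : Type*} {l : Filter ι} [l.NeBot]
    {s : ι → H →L[ℂ] H} {y : H →L[ℂ] H} (hs : ∀ i, s i ∈ A)
    (h : ∀ k, Tendsto (fun i => s i k) l (𝓝 (y k))) : y ∈ A := by
  rw [← SetLike.mem_coe, ← A.centralizer_centralizer]
  intro z hz
  ext k
  refine tendsto_nhds_unique ((z.continuous.tendsto _).comp (h k)) ((h (z k)).congr fun i => ?_)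
  exact congrArg (fun t : H →L[ℂ] H => t k) (hz _ (hs i))

variable {A : VonNeumannAlgebra H}

theorem isLUB_range_of_tendsto {ι : Type*} [Preorder ι] [IsDirectedOrder ι] [Nonempty ι]
    {s : ι → A} (hs : Monotone s) {x : A}
    (hx : ∀ k, Tendsto (fun i => (s i : H →L[ℂ] H) k) atTop (𝓝 ((x : H →L[ℂ] H) k))) :
    IsLUB (Set.range s) x := by
  refine ⟨?_, fun z hz => ?_⟩
  · rintro _ ⟨i, rfl⟩
    exact le_of_tendsto_apply (s := fun _ : ι => (s i : H →L[ℂ] H)) (fun _ => tendsto_const_nhds) hx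
      ((eventually_ge_atTop i).mono fun j hj => hs hj)
  · exact le_of_tendsto_apply (t := fun _ : ι => (z : H →L[ℂ] H)) hx (fun _ => tendsto_const_nhds)
      (Eventually.of_forall fun i => hz ⟨i, rfl⟩)

/-- Vigier's theorem: a bounded increasing net has a supremum, its strong limit. -/
theorem exists_isLUB_range {ι : Type*} [Preorder ι] [IsDirectedOrder ι] [Nonempty ι]
    {s : ι → A} (hs : Monotone s) (hb : BddAbove (Set.range s)) :
    ∃ x, IsLUB (Set.range s) x ∧
      ∀ k, Tendsto (fun i => (s i : H →L[ℂ] H) k) atTop (𝓝 ((x : H →L[ℂ] H) k)) := by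
  obtain ⟨z, hz⟩ := hb
  obtain ⟨y, hy⟩ := exists_strong_limit (fun i => (s i : H →L[ℂ] H)) (fun i j h => hs h) z
    (fun i => hz ⟨i, rfl⟩)
  exact ⟨⟨y, A.mem_of_tendsto_apply (fun i => (s i).2) hy⟩, isLUB_range_of_tendsto hs hy, hy⟩

theorem tendsto_of_isLUB_range {ι : Type*} [Preorder ι] [IsDirectedOrder ι] [Nonempty ι]
    {s : ι → A} (hs : Monotone s) {x : A} (hx : IsLUB (Set.range s) x) (k : H) :
    Tendsto (fun i => (s i : H →L[ℂ] H) k) atTop (𝓝 ((x : H →L[ℂ] H) k)) := by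
  obtain ⟨y, hy, hy'⟩ := exists_isLUB_range hs ⟨x, hx.1⟩
  rw [hx.unique hy]
  exact hy' k

theorem exists_isLUB {S : Set A} (hne : S.Nonempty) (hdir : DirectedOn (· ≤ ·) S)
    (hb : BddAbove S) : ∃ x, IsLUB S x := by
  have := hne.to_subtype
  have := hdir.isDirectedOrder
  obtain ⟨x, hx, -⟩ := exists_isLUB_range (s := ((↑) : S → A)) (Subtype.mono_coe S)
    (by rwa [Subtype.range_coe])
  exact ⟨x, by rwa [Subtype.range_coe] at hx⟩

theorem tendsto_of_isLUB {S : Set A} (hne : S.Nonempty) (hdir : DirectedOn (· ≤ ·) S) {x : A}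
    (hx : IsLUB S x) (k : H) :
    Tendsto (fun s : S => ((s : A) : H →L[ℂ] H) k) atTop (𝓝 ((x : H →L[ℂ] H) k)) := by
  have := hne.to_subtype
  have := hdir.isDirectedOrder
  exact tendsto_of_isLUB_range (s := ((↑) : S → A)) (Subtype.mono_coe S)
    (by rwa [Subtype.range_coe]) k

/-- Real-valued functionals that are continuous along bounded increasing nets. -/
def IsNormalFunctional (F : A →+ ℝ) : Prop :=
  ∀ S : Set A, S.Nonempty → (∀ s ∈ S, 0 ≤ s) → DirectedOn (· ≤ ·) S → ∀ x, IsLUB S x →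
    Tendsto (fun s : S => F s) atTop (𝓝 (F x))

/-- An exhaustion in the spirit of the Hahn decomposition: Zorn's lemma on the `a ∈ [0, z]` with `F
a ≥ 0`, ordered by `a ≤ b` together with `F a ≤ F b`. Nonempty chains have suprema by Vigier's
theorem, and normality controls `F` there. Beyond a maximal `a`, the functional is strictly negative
on the nonzero elements of `[0, z - a]`. -/
theorem exists_maximal_functional_nonneg {F : A →+ ℝ} (hF : IsNormalFunctional F) {z : A}
    (hz : 0 ≤ z) : ∃ a, 0 ≤ a ∧ a ≤ z ∧ 0 ≤ F a ∧ ∀ c, 0 ≤ c → c ≤ z - a → 0 ≤ F c → c = 0 := by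
  let r : {a : A // (0 ≤ a ∧ a ≤ z) ∧ 0 ≤ F a} → {a : A // (0 ≤ a ∧ a ≤ z) ∧ 0 ≤ F a} → Prop :=
    fun a b => a.1 ≤ b.1 ∧ F a.1 ≤ F b.1
  obtain ⟨m, hm⟩ := exists_maximal_of_chains_bounded (r := r) (fun c hc => by
    rcases c.eq_empty_or_nonempty with rfl | hcne
    · exact ⟨⟨0, ⟨le_rfl, hz⟩, by simp⟩, by simp⟩
    set S : Set A := Subtype.val '' c with hS
    have hne : S.Nonempty := hcne.image _
    have htot : ∀ a ∈ c, ∀ b ∈ c, r a b ∨ r b a := fun a ha b hb => by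
      by_cases h : a = b
      · subst h
        exact Or.inl ⟨le_rfl, le_rfl⟩
      · exact hc ha hb h
    have hdir : DirectedOn (· ≤ ·) S := by
      rintro _ ⟨a, ha, rfl⟩ _ ⟨b, hb, rfl⟩
      rcases htot a ha b hb with h | h
      · exact ⟨b, ⟨b, hb, rfl⟩, h.1, le_rfl⟩
      · exact ⟨a, ⟨a, ha, rfl⟩, le_rfl, h.1⟩
    have hle : ∀ s ∈ S, s ≤ z := by rintro _ ⟨a, -, rfl⟩; exact a.2.1.2
    have hpos : ∀ s ∈ S, 0 ≤ s := by rintro _ ⟨a, -, rfl⟩; exact a.2.1.1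
    have := hne.to_subtype
    have := hdir.isDirectedOrder
    obtain ⟨x, hx⟩ := exists_isLUB hne hdir ⟨z, hle⟩
    have hlim := hF S hne hpos hdir x hx
    have hFx : ∀ a ∈ c, F a.1 ≤ F x := by
      intro a ha
      refine ge_of_tendsto hlim ?_
      filter_upwards [eventually_ge_atTop (⟨a.1, a, ha, rfl⟩ : S)]
      rintro ⟨_, b, hb, rfl⟩ (h : a.1 ≤ b.1)
      -- If the chain order runs from `b` to `a`, then `a ≤ b` forces equality.
      rcases htot a ha b hb with h' | h'
      · exact h'.2
      · exact (congrArg F (le_antisymm h h'.1)).le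
    obtain ⟨a₀, ha₀⟩ := hcne
    exact ⟨⟨x, ⟨a₀.2.1.1.trans (hx.1 ⟨a₀, ha₀, rfl⟩), hx.2 hle⟩, a₀.2.2.trans (hFx a₀ ha₀)⟩,
      fun a ha => ⟨hx.1 ⟨a, ha, rfl⟩, hFx a ha⟩⟩)
    (fun h1 h2 => ⟨h1.1.trans h2.1, h1.2.trans h2.2⟩)
  refine ⟨m.1, m.2.1.1, m.2.1.2, m.2.2, fun c hc hcz hFc => ?_⟩
  have h1 := hm ⟨m.1 + c, ⟨add_nonneg m.2.1.1 hc, le_sub_iff_add_le'.mp hcz⟩, by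
    rw [map_add]; exact add_nonneg m.2.2 hFc⟩
    ⟨le_add_of_nonneg_right hc, by simpa using hFc⟩
  exact le_antisymm (by simpa using h1.1) hc

end VonNeumannAlgebra

/-! ### Operators prescribed on families that need not be total -/

section PartialExtension

variable {X K K' : Type*} [NormedAddCommGroup K] [InnerProductSpace ℂ K] [CompleteSpace K]
  [NormedAddCommGroup K'] [InnerProductSpace ℂ K']

theorem clm_eq_of_eq_on_orthogonal {F : Type*} [NormedAddCommGroup F] [NormedSpace ℂ F] {f : X → K}
    {S T : K →L[ℂ] F} (h : ∀ x, S (f x) = T (f x))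
    (h' : ∀ u, (∀ x, inner ℂ (f x) u = 0) → S u = T u) : S = T := by
  ext k
  set N := (Submodule.span ℂ (Set.range f)).topologicalClosure with hN
  have : CompleteSpace N :=
    (Submodule.isClosed_topologicalClosure (Submodule.span ℂ (Set.range f))).completeSpace_coe
  have h1 : N ≤ LinearMap.eqLocus (S : K →ₗ[ℂ] F) (T : K →ₗ[ℂ] F) := by
    refine Submodule.topologicalClosure_minimal _ (Submodule.span_le.mpr ?_) ?_
    · rintro _ ⟨x, rfl⟩
      exact h x
    · exact isClosed_eq S.continuous T.continuous
  obtain ⟨y, hy, z, hz, rfl⟩ := N.exists_add_mem_mem_orthogonal k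
  rw [map_add, map_add, show S y = T y from h1 hy, h' z fun x => ?_]
  exact hz _ (Submodule.le_topologicalClosure _ (Submodule.subset_span ⟨x, rfl⟩))

/-- The operator is extended from the closed span by the orthogonal projection. Vanishing on the
complement is what later lets the intertwining relation be checked on all of `K`. -/
theorem exists_clm_of_norm_le_of_orthogonal [CompleteSpace K'] {f : X → K} {g : X → K'} (C : ℝ)
    (h : ∀ m, ‖Finsupp.linearCombination ℂ g m‖ ≤ C * ‖Finsupp.linearCombination ℂ f m‖) :
    ∃ T : K →L[ℂ] K', (∀ x, T (f x) = g x) ∧ ∀ u, (∀ x, inner ℂ (f x) u = 0) → T u = 0 := by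
  set N := (Submodule.span ℂ (Set.range f)).topologicalClosure with hN
  have : CompleteSpace N :=
    (Submodule.isClosed_topologicalClosure (Submodule.span ℂ (Set.range f))).completeSpace_coe
  have hfN : ∀ x, f x ∈ N := fun x =>
    Submodule.le_topologicalClosure _ (Submodule.subset_span ⟨x, rfl⟩)
  let f' : X → N := fun x => ⟨f x, hfN x⟩
  have hcoe : ∀ m, ((Finsupp.linearCombination ℂ f' m : N) : K) =
      Finsupp.linearCombination ℂ f m := by
    intro m
    simp [Finsupp.linearCombination_apply, Finsupp.sum, f']
  have htot : Dense (Submodule.span ℂ (Set.range f') : Set N) := by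
    have h1 : N.subtypeL '' (Submodule.span ℂ (Set.range f') : Set N) =
        Submodule.span ℂ (Set.range f) := by
      have := Submodule.map_span N.subtype (Set.range f')
      rw [← Set.range_comp] at this
      exact congrArg (fun p : Submodule ℂ K => (p : Set K)) this
    intro k
    rw [Topology.IsInducing.subtypeVal.closure_eq_preimage_closure_image]
    change (k : K) ∈ closure (N.subtypeL '' (Submodule.span ℂ (Set.range f') : Set N))
    rw [h1]
    exact k.2
  obtain ⟨T, hT⟩ := exists_clm_of_norm_le (g := g) htot C fun m => by
    rw [← Submodule.norm_coe, hcoe]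
    exact h m
  refine ⟨T ∘L N.orthogonalProjectionOnto, fun x => ?_, fun u hu => ?_⟩
  · rw [← hT x]
    exact congrArg T (N.orthogonalProjectionOnto_mem_subspace_eq_self (f' x))
  · have h1 : u ∈ Nᗮ := by
      rw [hN, Submodule.orthogonal_closure]
      refine (Submodule.mem_orthogonal _ _).mpr fun v hv => ?_
      induction hv using Submodule.span_induction with
      | mem v hv => obtain ⟨x, rfl⟩ := hv; exact hu x
      | zero => simp
      | add v w _ _ hv hw => rw [inner_add_left, hv, hw, add_zero]
      | smul c v _ hv => rw [inner_smul_left, hv, mul_zero]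
    rw [ContinuousLinearMap.comp_apply, N.orthogonalProjectionOnto_apply_of_mem_orthogonal h1,
      map_zero]

end PartialExtension

/-! ### Intertwiners into normal representations -/

namespace VonNeumannAlgebra

variable {H L : Type*} [NormedAddCommGroup H] [InnerProductSpace ℂ H] [CompleteSpace H]
  [NormedAddCommGroup L] [InnerProductSpace ℂ L] [CompleteSpace L] {A : VonNeumannAlgebra H}

/-- The functional `a ↦ ⟨π(a) ξ, ξ⟩`. -/
noncomputable def vectorFunctional (π : A →⋆ₐ[ℂ] (L →L[ℂ] L)) (ξ : L) : A →+ ℝ where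
  toFun a := (inner ℂ (π a ξ) ξ).re
  map_zero' := by simp
  map_add' a b := by simp

theorem vectorFunctional_star_mul_self (π : A →⋆ₐ[ℂ] (L →L[ℂ] L)) (ξ : L) (a : A) :
    vectorFunctional π ξ (star a * a) = ‖π a ξ‖ ^ 2 := by
  change (inner ℂ (π (star a * a) ξ) ξ).re = _
  rw [map_mul, map_star, ContinuousLinearMap.star_eq_adjoint]
  change (inner ℂ ((π a).adjoint (π a ξ)) ξ).re = _
  rw [ContinuousLinearMap.adjoint_inner_left]
  exact inner_self_eq_norm_sq (𝕜 := ℂ) _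

theorem vectorFunctional_nonneg (π : A →⋆ₐ[ℂ] (L →L[ℂ] L)) (ξ : L) {a : A} (ha : 0 ≤ a) :
    0 ≤ vectorFunctional π ξ a := by
  obtain ⟨c, rfl⟩ := CStarAlgebra.nonneg_iff_eq_star_mul_self.mp ha
  rw [vectorFunctional_star_mul_self]
  positivity

variable (A) in
/-- The identity representation of a von Neumann algebra. -/
noncomputable def idRep : A →⋆ₐ[ℂ] (H →L[ℂ] H) := A.toStarSubalgebra.subtype

@[simp] theorem idRep_apply (a : A) : idRep A a = a := rfl

theorem isNormalFunctional_idRep (h : H) : IsNormalFunctional (vectorFunctional (idRep A) h) := by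
  intro S hne _ hdir x hx
  exact (Complex.continuous_re.tendsto _).comp
    ((tendsto_of_isLUB hne hdir hx h).inner tendsto_const_nhds)

/-- Domination is applied to the positive differences `x - s`: `0 ≤ φ (x - s) ≤ ψ (x - s) → 0`. -/
theorem IsNormalFunctional.of_le {φ ψ : A →+ ℝ} (hψ : IsNormalFunctional ψ)
    (h0 : ∀ a, 0 ≤ a → 0 ≤ φ a) (h : ∀ a, 0 ≤ a → φ a ≤ ψ a) : IsNormalFunctional φ := by
  intro S hne hpos hdir x hx
  have h1 : Tendsto (fun s : S => φ (x - s)) atTop (𝓝 0) := by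
    have h2 : Tendsto (fun s : S => ψ (x - s)) atTop (𝓝 0) := by
      simpa using (hψ S hne hpos hdir x hx).const_sub (ψ x)
    exact squeeze_zero (fun s => h0 _ (sub_nonneg.mpr (hx.1 s.2)))
      (fun s => h _ (sub_nonneg.mpr (hx.1 s.2))) h2
  simpa using h1.const_sub (φ x)

/-- A nonzero normal positive functional is dominated by a vector functional on a nonzero part of
the algebra. -/
theorem exists_norm_apply_le (π : A →⋆ₐ[ℂ] (L →L[ℂ] L)) {ξ : L} (hξ : ξ ≠ 0)
    (hn : IsNormalFunctional (vectorFunctional π ξ)) :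
    ∃ (s : A) (h : H), π s ξ ≠ 0 ∧
      ∀ a : A, ‖π (a * s) ξ‖ ≤ ‖((a * s : A) : H →L[ℂ] H) h‖ := by
  set φ := vectorFunctional π ξ with hφ
  have hφ1 : 0 < φ 1 := by
    have := vectorFunctional_star_mul_self π ξ 1
    rw [star_one, one_mul] at this
    rw [hφ, this, map_one]
    exact pow_pos (norm_pos_iff.mpr hξ) 2
  have hneg : IsNormalFunctional (-φ) := fun S h1 h2 h3 x hx => (hn S h1 h2 h3 x hx).neg
  -- For `-φ` the maximal element satisfies `φ n = 0`, and `φ` is faithful on `[0, 1 - n]`; thus `1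
  -- - n` plays the role of the support projection of `φ`.
  obtain ⟨n, hn0, hn1, hn2, hn3⟩ := exists_maximal_functional_nonneg hneg
    (zero_le_one (α := A))
  have hφn : 0 ≤ -φ n := hn2
  have hz0 : 0 ≤ 1 - n := sub_nonneg.mpr hn1
  have hz : 1 - n ≠ 0 := by
    intro h
    rw [← sub_eq_zero.mp h] at hφn
    linarith
  -- A large multiple of a vector not killed by `1 - n`; it prevents the next maximal element from
  -- being all of `1 - n`.
  obtain ⟨h, hh⟩ : ∃ h, φ (1 - n) < vectorFunctional (idRep A) h (1 - n) := by
    obtain ⟨c, hc⟩ := CStarAlgebra.nonneg_iff_eq_star_mul_self.mp hz0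
    have hc0 : (c : H →L[ℂ] H) ≠ 0 := by
      intro h
      rw [show c = 0 from Subtype.ext h, mul_zero] at hc
      exact hz hc
    obtain ⟨k, hk⟩ : ∃ k, (c : H →L[ℂ] H) k ≠ 0 := by
      by_contra! h
      exact hc0 (ContinuousLinearMap.ext h)
    have hk0 : 0 < ‖(c : H →L[ℂ] H) k‖ := norm_pos_iff.mpr hk
    obtain ⟨t, ht⟩ := exists_nat_gt (φ (1 - n) / ‖(c : H →L[ℂ] H) k‖ ^ 2)
    refine ⟨((t + 1 : ℕ) : ℂ) • k, ?_⟩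
    rw [show vectorFunctional (idRep A) (((t + 1 : ℕ) : ℂ) • k) (1 - n) =
        ‖((t + 1 : ℕ) : ℂ)‖ ^ 2 * ‖(c : H →L[ℂ] H) k‖ ^ 2 by
      rw [hc, vectorFunctional_star_mul_self, idRep_apply, map_smul, norm_smul, mul_pow]]
    rw [div_lt_iff₀ (by positivity)] at ht
    refine ht.trans_le ?_
    gcongr
    rw [Complex.norm_natCast]
    push_cast
    nlinarith [(Nat.cast_nonneg t : (0 : ℝ) ≤ t)]
  set ω := vectorFunctional (idRep A) h with hω
  have hsub : IsNormalFunctional (φ - ω) := fun S h1 h2 h3 x hx =>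
    (hn S h1 h2 h3 x hx).sub (isNormalFunctional_idRep h S h1 h2 h3 x hx)
  -- The remainder `r = 1 - n - a` is nonzero by the choice of `h`, and maximality gives `φ ≤ ω` on
  -- `[0, r]`.
  obtain ⟨a, ha0, ha1, ha2, ha3⟩ := exists_maximal_functional_nonneg hsub hz0
  have hFa : 0 ≤ φ a - ω a := ha2
  have hr0 : 0 ≤ 1 - n - a := sub_nonneg.mpr ha1
  have hr : 1 - n - a ≠ 0 := by
    intro h
    rw [← sub_eq_zero.mp h] at hFa
    linarith
  have hle : ∀ c, 0 ≤ c → c ≤ 1 - n - a → φ c ≤ ω c := by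
    intro c hc hc'
    by_contra! hlt
    have := ha3 c hc hc' (by change 0 ≤ φ c - ω c; linarith)
    rw [this, map_zero, map_zero] at hlt
    exact lt_irrefl _ hlt
  obtain ⟨s, hs⟩ := CStarAlgebra.nonneg_iff_eq_star_mul_self.mp hr0
  refine ⟨s, h, ?_, ?_⟩
  · intro h0
    refine hr (hn3 _ hr0 (sub_le_self _ ha0) ?_)
    change 0 ≤ -φ _
    rw [hs, hφ, vectorFunctional_star_mul_self, h0]
    simp
  -- For a contraction `b`, `(b s)* (b s) ≤ s* s = r`, so `φ ≤ ω` on `[0, r]` becomes a comparison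
  -- of norms; the general case follows by scaling.
  · have key : ∀ b : A, star b * b ≤ 1 → ‖π (b * s) ξ‖ ≤ ‖((b * s : A) : H →L[ℂ] H) h‖ := by
      intro b hb
      have h1 : star (b * s) * (b * s) ≤ 1 - n - a := by
        rw [hs]
        have := star_left_conjugate_le_conjugate hb s
        rw [mul_one] at this
        refine le_trans (le_of_eq ?_) this
        simp only [star_mul, mul_assoc]
      have h2 := hle _ (star_mul_self_nonneg _) h1
      rw [hφ, hω, vectorFunctional_star_mul_self, vectorFunctional_star_mul_self] at h2
      exact le_of_sq_le_sq h2 (norm_nonneg _)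
    intro b
    obtain ⟨t, ht⟩ := exists_nat_gt ‖b‖
    have ht0 : (0 : ℝ) < t := (norm_nonneg b).trans_lt ht
    have h1 := key (((t : ℝ)⁻¹ : ℂ) • b) (by
      refine CStarAlgebra.star_mul_le_algebraMap_norm_sq.trans ?_
      have h2 : ‖((t : ℝ)⁻¹ : ℂ) • b‖ ≤ 1 := by
        rw [norm_smul]
        simp only [norm_inv, Complex.norm_real, Real.norm_natCast]
        rw [inv_mul_le_iff₀ ht0]
        linarith
      rw [← map_one (algebraMap ℝ A)]
      exact algebraMap_mono A (pow_le_one₀ (norm_nonneg _) h2))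
    rw [smul_mul_assoc, map_smul] at h1
    have h3 : ((((t : ℝ)⁻¹ : ℂ) • (b * s) : A) : H →L[ℂ] H) h =
      ((t : ℝ)⁻¹ : ℂ) • ((b * s : A) : H →L[ℂ] H) h := rfl
    rw [h3, smul_apply, norm_smul, norm_smul] at h1
    refine le_of_mul_le_mul_left h1 ?_
    simpa using ht0

/-- Bounded operators intertwining the identity representation with `π`. -/
def IsIntertwiner (π : A →⋆ₐ[ℂ] (L →L[ℂ] L)) (T : H →L[ℂ] L) : Prop :=
  ∀ (a : A) (h : H), T ((a : H →L[ℂ] H) h) = π a (T h)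

theorem exists_intertwiner (π : A →⋆ₐ[ℂ] (L →L[ℂ] L)) {ξ : L} (hξ : ξ ≠ 0)
    (hn : IsNormalFunctional (vectorFunctional π ξ)) :
    ∃ T : H →L[ℂ] L, IsIntertwiner π T ∧ T ≠ 0 ∧
      ∀ u, (∀ a, inner ℂ u (π a ξ) = 0) → ∀ h, inner ℂ u (T h) = 0 := by
  obtain ⟨s, h, hs, hle⟩ := exists_norm_apply_le π hξ hn
  set f : A → H := fun a => ((a * s : A) : H →L[ℂ] H) h with hf
  set g : A → L := fun a => π (a * s) ξ with hg
  -- The operator `a s h ↦ π(a s) ξ`. Both families are linear in `a`, so a linear combination is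
  -- again a member and `hle` applies to it.
  obtain ⟨T, hT, hT'⟩ := exists_clm_of_norm_le_of_orthogonal (f := f) (g := g) 1 fun m => by
    have h1 : Finsupp.linearCombination ℂ f m = f (Finsupp.linearCombination ℂ id m) := by
      induction m using Finsupp.induction_linear with
      | zero => simp [hf]
      | add m m' h1 h2 => rw [map_add, map_add, h1, h2]; simp [hf]
      | single a c =>
        simp only [Finsupp.linearCombination_single, hf, id, smul_mul_assoc]
        rfl
    have h2 : Finsupp.linearCombination ℂ g m = g (Finsupp.linearCombination ℂ id m) := by
      clear h1
      induction m using Finsupp.induction_linear with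
      | zero => simp [hg]
      | add m m' h1 h2 => rw [map_add, map_add, h1, h2]; simp [hg]
      | single a c => simp [hg]
    rw [h1, h2, one_mul]
    exact hle _
  refine ⟨T, fun a k => ?_, ?_, fun u hu k => ?_⟩
  · have : T ∘L (a : H →L[ℂ] H) = π a ∘L T := by
      refine clm_eq_of_eq_on_orthogonal (f := f) (fun b => ?_) fun u hu => ?_
      · have h1 : (a : H →L[ℂ] H) (f b) = f (a * b) := by
          simp [hf]
        rw [ContinuousLinearMap.comp_apply, ContinuousLinearMap.comp_apply, h1, hT, hT]
        simp [hg]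
      -- Since `A` is closed under adjoints, the orthogonal complement of `A s h` is `A`-invariant,
      -- and `T` vanishes on it.
      · rw [ContinuousLinearMap.comp_apply, ContinuousLinearMap.comp_apply, hT' u hu, map_zero]
        refine hT' _ fun b => ?_
        rw [← ContinuousLinearMap.adjoint_inner_left, ← ContinuousLinearMap.star_eq_adjoint]
        have h1 : (star (a : H →L[ℂ] H)) (f b) = f (star a * b) := by
          simp [hf]
        rw [h1]
        exact hu _
    exact congrArg (fun t : H →L[ℂ] L => t k) this
  · rintro rfl
    have := hT 1
    simp only [hg, one_mul] at this
    exact hs this.symm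
  · have : innerSL ℂ u ∘L T = 0 := by
      refine clm_eq_of_eq_on_orthogonal (f := f) (fun b => ?_) fun v hv => ?_
      · rw [ContinuousLinearMap.comp_apply, hT, innerSL_apply_apply]
        exact hu _
      · simp [hT' v hv]
    simpa using congrArg (fun t : H →L[ℂ] ℂ => t k) this

/-- The ranges of the intertwiners span a normal representation. -/
theorem dense_span_intertwiner {X : Type*} (π : A →⋆ₐ[ℂ] (L →L[ℂ] L)) {e : X → L}
    (htot : Dense (Submodule.span ℂ (Set.range e) : Set L))
    (hn : ∀ x, IsNormalFunctional (vectorFunctional π (e x))) :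
    Dense (Submodule.span ℂ {k : L | ∃ T : H →L[ℂ] L, IsIntertwiner π T ∧ ∃ h, k = T h} :
      Set L) := by
  set N₀ := Submodule.span ℂ {k : L | ∃ T : H →L[ℂ] L, IsIntertwiner π T ∧ ∃ h, k = T h}
  set N := N₀.topologicalClosure with hN
  have : CompleteSpace N := (Submodule.isClosed_topologicalClosure N₀).completeSpace_coe
  have hinv : ∀ a, ∀ k ∈ N, π a k ∈ N := by
    intro a k hk
    have : N ≤ N.comap (π a : L →ₗ[ℂ] L) := by
      refine Submodule.topologicalClosure_minimal _ (Submodule.span_le.mpr ?_) ?_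
      · rintro _ ⟨T, hT, h, rfl⟩
        refine Submodule.le_topologicalClosure _ (Submodule.subset_span ⟨T, hT, _, (hT a h).symm⟩)
      · exact (Submodule.isClosed_topologicalClosure N₀).preimage (π a).continuous
    exact this hk
  have hinv' : ∀ a, ∀ k ∈ Nᗮ, π a k ∈ Nᗮ := by
    intro a k hk
    refine (Submodule.mem_orthogonal _ _).mpr fun v hv => ?_
    rw [← ContinuousLinearMap.adjoint_inner_left, ← ContinuousLinearMap.star_eq_adjoint, ← map_star]
    exact hk _ (hinv _ _ hv)
  rw [Submodule.dense_iff_topologicalClosure_eq_top, eq_top_iff]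
  by_contra hcon
  have hx : ∃ x, e x ∉ N := by
    by_contra! hx
    refine hcon ?_
    rw [← Submodule.dense_iff_topologicalClosure_eq_top.mp htot]
    refine Submodule.topologicalClosure_minimal _ (Submodule.span_le.mpr ?_)
      (Submodule.isClosed_topologicalClosure N₀)
    rintro _ ⟨x, rfl⟩
    exact hx x
  obtain ⟨x, hx⟩ := hx
  obtain ⟨y, hy, ξ, hξ, hxy⟩ := N.exists_add_mem_mem_orthogonal (e x)
  have hξ0 : ξ ≠ 0 := by
    rintro rfl
    rw [add_zero] at hxy
    exact hx (hxy ▸ hy)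
  -- The vectors `π(c) y` and `π(c) ξ` are orthogonal, so by Pythagoras the functional of `ξ` is
  -- dominated by the normal functional of `e x = y + ξ`.
  have hdom : IsNormalFunctional (vectorFunctional π ξ) := by
    refine (hn x).of_le (fun a ha => vectorFunctional_nonneg π ξ ha) fun a ha => ?_
    obtain ⟨c, rfl⟩ := CStarAlgebra.nonneg_iff_eq_star_mul_self.mp ha
    rw [vectorFunctional_star_mul_self, vectorFunctional_star_mul_self, hxy, map_add]
    have h1 : inner ℂ (π c y) (π c ξ) = 0 := hinv' c ξ hξ _ (hinv c y hy)
    rw [@norm_add_sq ℂ, h1]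
    simp
  -- The range of `T` lies in `N` by the definition of `N`, hence is orthogonal to `π(A) ξ ⊆ Nᗮ`. By
  -- `hTu` each `T h` is then orthogonal to itself, against `T ≠ 0`.
  obtain ⟨T, hT, hT0, hTu⟩ := exists_intertwiner π hξ0 hdom
  refine hT0 (ContinuousLinearMap.ext fun h => ?_)
  have hTh : T h ∈ N :=
    Submodule.le_topologicalClosure _ (Submodule.subset_span ⟨T, hT, h, rfl⟩)
  exact inner_self_eq_zero.mp (hTu (T h) (fun a => hinv' a ξ hξ _ hTh) h)

end VonNeumannAlgebra

/-! ### Positive definite operator-valued kernels -/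

section Kernel

variable {H : Type u} [NormedAddCommGroup H] [InnerProductSpace ℂ H] [CompleteSpace H]
  {A : VonNeumannAlgebra H}

/-- Positive definite `A`-valued kernels. -/
def IsPositiveKernel {X : Type u} (k : X → X → A) : Prop :=
  ∀ (n : Type u) [Fintype n] (x : n → X),
    (0 : CStarMatrix n n A) ≤ CStarMatrix.ofMatrix (Matrix.of fun i j => k (x i) (x j))

theorem IsPositiveKernel.comp {X Y : Type u} {k : X → X → A} (hk : IsPositiveKernel k)
    (f : Y → X) : IsPositiveKernel fun y y' => k (f y) (f y') :=
  fun n _ x => hk n (f ∘ x)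

/-- A positive matrix is a sum of matrices `N* N`, and for each of these the double sum is `∑ₗ (∑ᵢ
Nₗᵢ xᵢ)* (∑ⱼ Nₗⱼ xⱼ)`. -/
theorem sum_star_mul_mul_nonneg {n : Type*} [Fintype n] {M : CStarMatrix n n A} (hM : 0 ≤ M)
    (x : n → H →L[ℂ] H) :
    0 ≤ ∑ i, ∑ j, star (x i) * (M i j : H →L[ℂ] H) * x j := by
  rw [StarOrderedRing.nonneg_iff] at hM
  induction hM using AddSubmonoid.closure_induction with
  | mem M hM =>
    obtain ⟨N, rfl⟩ := hM
    have h1 : ∑ i, ∑ j, star (x i) * ((star N * N) i j : H →L[ℂ] H) * x j =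
        ∑ l, star (∑ i, (N l i : H →L[ℂ] H) * x i) * ∑ j, (N l j : H →L[ℂ] H) * x j := by
      have h2 : ∀ i j, ((star N * N) i j : H →L[ℂ] H) =
          ∑ l, star (N l i : H →L[ℂ] H) * (N l j : H →L[ℂ] H) := by
        intro i j
        have h3 : (star N * N) i j = ∑ l, star (N l i) * N l j := rfl
        rw [h3]
        exact map_sum A.toStarSubalgebra.subtype _ _
      simp only [h2, star_sum, star_mul, Finset.sum_mul, Finset.mul_sum]
      calc _ = ∑ i, ∑ l, ∑ j, star (x i) * (star (N l i : H →L[ℂ] H) * (N l j : H →L[ℂ] H)) * x j :=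
            Finset.sum_congr rfl fun i _ => Finset.sum_comm
        _ = ∑ l, ∑ i, ∑ j, star (x i) * (star (N l i : H →L[ℂ] H) * (N l j : H →L[ℂ] H)) * x j :=
            Finset.sum_comm
        _ = _ := Finset.sum_congr rfl fun l _ => by
            rw [Finset.sum_comm]
            refine Finset.sum_congr rfl fun i _ => Finset.sum_congr rfl fun j _ => ?_
            simp only [mul_assoc]
    rw [h1]
    exact Finset.sum_nonneg fun l _ => star_mul_self_nonneg _
  | zero => simp
  | add M N _ _ hM hN =>
    refine (add_nonneg hM hN).trans_eq ?_
    simp only [← Finset.sum_add_distrib]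
    refine Finset.sum_congr rfl fun i _ => Finset.sum_congr rfl fun j _ => ?_
    rw [← add_mul, ← mul_add]
    rfl

/-- An off-diagonal entry of the two-point Gram matrix, which is self-adjoint; `ULift` only adjusts
the universe. -/
theorem IsPositiveKernel.star_apply {X : Type u} {k : X → X → A} (hk : IsPositiveKernel k)
    (x y : X) : star (k x y) = k y x := by
  have h := IsSelfAdjoint.of_nonneg (hk (ULift.{u} Bool) fun b => if b.down then x else y)
  exact congrArg (fun M : CStarMatrix (ULift.{u} Bool) (ULift.{u} Bool) A => M ⟨false⟩ ⟨true⟩) h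

/-- The Kolmogorov decomposition of a positive definite kernel. -/
theorem IsPositiveKernel.exists_decomposition {X : Type u} {k : X → X → A}
    (hk : IsPositiveKernel k) :
    ∃ (K : Type u) (_ : NormedAddCommGroup K) (_ : InnerProductSpace ℂ K) (_ : CompleteSpace K)
      (w : X → H →L[ℂ] K),
      (∀ x y h h', inner ℂ (w x h) (w y h') = inner ℂ h ((k x y : H →L[ℂ] H) h')) ∧
      Dense (Submodule.span ℂ (Set.range fun p : X × H => w p.1 p.2) : Set K) := by
  let M : Matrix X X (H →L[ℂ] H) := Matrix.of fun x y => (k x y : H →L[ℂ] H)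
  have hM : M.PosSemidef := by
    refine ⟨?_, fun x => ?_⟩
    · ext1 x y
      exact congrArg Subtype.val (hk.star_apply y x)
    · have h1 := sum_star_mul_mul_nonneg (hk x.support fun i => i) fun i => x i
      refine h1.trans_eq ?_
      simp only [Finsupp.sum]
      rw [← Finset.sum_coe_sort x.support]
      refine Finset.sum_congr rfl fun i _ => ?_
      rw [← Finset.sum_coe_sort x.support]
      rfl
  have : Fact M.PosSemidef := ⟨hM⟩
  refine ⟨RKHS.OfKernel M, inferInstance, inferInstance, inferInstance,
    RKHS.kerFun (RKHS.OfKernel M), fun x y h h' => ?_, ?_⟩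
  · have h1 := RKHS.kernel_apply (RKHS.OfKernel M) x y
    rw [RKHS.OfKernel.kernel_ofKernel] at h1
    change _ = inner ℂ h (M x y h')
    rw [h1, ContinuousLinearMap.comp_apply, ContinuousLinearMap.adjoint_inner_right]
  · rw [Submodule.dense_iff_topologicalClosure_eq_top, ← RKHS.kerFun_dense (RKHS.OfKernel M)]
    congr 2
    ext v
    simp

end Kernel

/-! ### The kernel on words defined by `τ` -/

namespace NormalUCPMap

variable {H : Type u} [NormedAddCommGroup H] [InnerProductSpace ℂ H] [CompleteSpace H]
  {A : VonNeumannAlgebra H}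

/-- `chain τ [x₁, …, xₙ] [y₁, …, yₘ]` is `τ(x₁* τ(x₂* ⋯ y₂) y₁)`, the shorter list being continued
by ones. -/
noncomputable def chain (τ : NormalUCPMap A) : List A → List A → A
  | [], [] => 1
  | x :: l, [] => τ (star x * chain τ l [])
  | [], y :: l' => τ (chain τ [] l' * y)
  | x :: l, y :: l' => τ (star x * chain τ l l' * y)
termination_by l l' => l.length + l'.length

variable (τ : NormalUCPMap A)

theorem chain_nil_nil : τ.chain [] [] = 1 := by rw [chain]

theorem chain_cons_cons (x y : A) (l l' : List A) :
    τ.chain (x :: l) (y :: l') = τ (star x * τ.chain l l' * y) := by rw [chain]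

/-- A missing letter counts as `1`, and `τ 1 = 1` covers two empty words, so a single recursion
serves all four cases. -/
theorem chain_eq (l l' : List A) :
    τ.chain l l' = τ (star (l.headD 1) * τ.chain l.tail l'.tail * l'.headD 1) := by
  cases l <;> cases l' <;> simp [chain, τ.map_one]

theorem chain_append_one_right (l l' : List A) : τ.chain l (l' ++ [1]) = τ.chain l l' := by
  induction l' generalizing l with
  | nil => rw [chain_eq τ l [], chain_eq]; simp
  | cons y l' ih => rw [List.cons_append, chain_eq, chain_eq τ l (y :: l')]; simp [ih]

open CStarMatrix in
-- Induction on the maximal length. By `chain_eq` the Gram matrix is `τ` applied entrywise to `R* M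
-- R`, with `M` the Gram matrix of the tails and `R` the diagonal matrix of the heads; complete
-- positivity does the rest.
theorem isPositiveKernel_chain : IsPositiveKernel τ.chain := by
  have key : ∀ (N : ℕ) (n : Type u) [Fintype n] (l : n → List A), (∀ i, (l i).length ≤ N) →
      (0 : CStarMatrix n n A) ≤ ofMatrix (Matrix.of fun i j => τ.chain (l i) (l j)) := by
    classical
    intro N
    induction N with
    | zero =>
      intro n _ l hl
      have hl' : ∀ i, l i = [] := fun i => List.eq_nil_of_length_eq_zero (Nat.le_zero.mp (hl i))
      simp only [hl', chain_nil_nil]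
      rcases isEmpty_or_nonempty n with hn | ⟨⟨k⟩⟩
      · exact le_of_eq (CStarMatrix.ext fun i => hn.elim i)
      -- The all-ones matrix is `R* R`, where `R` has ones in row `k` and zeros elsewhere.
      · let R : CStarMatrix n n A := ofMatrix (Matrix.of fun i _ => if i = k then 1 else 0)
        refine (star_mul_self_nonneg R).trans_eq ?_
        refine CStarMatrix.ext fun i j => ?_
        change (∑ a, star (if a = k then (1 : A) else 0) * (if a = k then (1 : A) else 0) : A) = 1
        simp
    | succ N ih =>
      intro n _ l hl
      have h1 := ih n (fun i => (l i).tail) fun i => by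
        have := hl i
        simp only [List.length_tail]
        omega
      let R : CStarMatrix n n A := ofMatrix (Matrix.diagonal fun i => (l i).headD 1)
      have h2 := τ.toCompletelyPositiveMap.map_cstarMatrix_nonneg _
        (star_left_conjugate_nonneg h1 R)
      refine h2.trans_eq ?_
      refine CStarMatrix.ext fun i j => ?_
      change τ ((Matrix.conjTranspose (Matrix.diagonal fun i => (l i).headD 1) *
        (Matrix.of fun i j => τ.chain (l i).tail (l j).tail) *
          Matrix.diagonal fun i => (l i).headD 1) i j) = τ.chain (l i) (l j)
      rw [Matrix.diagonal_conjTranspose, Matrix.mul_diagonal, Matrix.diagonal_mul, chain_eq τ (l i)]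
      rfl
  intro n _ l
  exact key (Finset.univ.sup fun i => (l i).length) n l fun i =>
    Finset.le_sup (f := fun i => (l i).length) (Finset.mem_univ i)

end NormalUCPMap

/-! ### Commutants and their action on Kolmogorov spaces -/

namespace VonNeumannAlgebra

/-- The commutant of a *-closed set of operators. -/
noncomputable def ofCentralizer {K : Type u} [NormedAddCommGroup K] [InnerProductSpace ℂ K]
    [CompleteSpace K] (S : Set (K →L[ℂ] K)) (hS : ∀ x ∈ S, star x ∈ S) : VonNeumannAlgebra K where
  toStarSubalgebra :=
    { Subalgebra.centralizer ℂ S with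
      star_mem' := fun ha => Set.star_mem_centralizer' hS ha }
  centralizer_centralizer' := Set.centralizer_centralizer_centralizer S

theorem coe_ofCentralizer {K : Type u} [NormedAddCommGroup K] [InnerProductSpace ℂ K]
    [CompleteSpace K] (S : Set (K →L[ℂ] K)) (hS : ∀ x ∈ S, star x ∈ S) :
    (ofCentralizer S hS : Set (K →L[ℂ] K)) = Set.centralizer S := rfl

variable {H : Type u} [NormedAddCommGroup H] [InnerProductSpace ℂ H] [CompleteSpace H]
  {A : VonNeumannAlgebra H}

theorem commutant_apply_comm (a : A) (b : A.commutant) (h : H) :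
    (a : H →L[ℂ] H) ((b : H →L[ℂ] H) h) = (b : H →L[ℂ] H) ((a : H →L[ℂ] H) h) :=
  congrArg (fun t : H →L[ℂ] H => t h) (mem_commutant_iff.mp b.2 a a.2)

/-- The commutant of `A` is represented on the Kolmogorov decomposition of an `A`-valued kernel. -/
theorem exists_commutant_representation {X K : Type*} [NormedAddCommGroup K]
    [InnerProductSpace ℂ K] [CompleteSpace K] {k : X → X → A} {w : X → H →L[ℂ] K}
    (hw : ∀ x y h h', inner ℂ (w x h) (w y h') = inner ℂ h ((k x y : H →L[ℂ] H) h'))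
    (htot : Dense (Submodule.span ℂ (Set.range fun p : X × H => w p.1 p.2) : Set K)) :
    ∃ ρ : A.commutant →⋆ₐ[ℂ] (K →L[ℂ] K), ∀ a x h, ρ a (w x h) = w x ((a : H →L[ℂ] H) h) := by
  let g : A.commutant →ₗ[ℂ] (X × H → K) :=
    { toFun := fun a p => w p.1 ((a : H →L[ℂ] H) p.2)
      map_add' := fun a b => by ext p; simp
      map_smul' := fun c a => by
        ext p
        exact map_smul (w p.1) c ((a : H →L[ℂ] H) p.2) }
  obtain ⟨ρ, hρ⟩ := exists_starAlgHom_of_inner_eq g htot fun b c p q => by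
    change inner ℂ (w p.1 ((b : H →L[ℂ] H) p.2)) (w q.1 ((c : H →L[ℂ] H) q.2)) =
      inner ℂ (w p.1 p.2) (w q.1 ((star b : H →L[ℂ] H) ((c : H →L[ℂ] H) q.2)))
    rw [hw, hw]
    -- The kernel takes values in `A`, so `b*` passes through it; this is the required invariance.
    have h1 := commutant_apply_comm (k p.1 q.1) (star b) ((c : H →L[ℂ] H) q.2)
    change _ = (star (b : H →L[ℂ] H)) _ at h1
    refine Eq.trans ?_ (congrArg (inner ℂ p.2) h1).symm
    rw [ContinuousLinearMap.star_eq_adjoint, ContinuousLinearMap.adjoint_inner_right]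
  exact ⟨ρ, fun a x h => hρ a (x, h)⟩

end VonNeumannAlgebra

/-! ### The dilation space and the Stinespring space -/

open VonNeumannAlgebra

/-- The spaces on which the dilation is built: `K` is spanned by vectors `w [x₁, …, xₙ] h` playing
the role of `θⁿ(xₙ) ⋯ θ(x₁) h`, and `L` is the Stinespring space of `τ`, spanned by
vectors `e x h` playing the role of `x ⊗ h`. -/
structure DilationSpaces {H : Type u} [NormedAddCommGroup H] [InnerProductSpace ℂ H]
    [CompleteSpace H] {A : VonNeumannAlgebra H} (τ : NormalUCPMap A) where
  K : Type u
  [normedAddCommGroupK : NormedAddCommGroup K]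
  [innerProductSpaceK : InnerProductSpace ℂ K]
  [completeSpaceK : CompleteSpace K]
  w : List A → H →L[ℂ] K
  inner_w : ∀ l l' h h', inner ℂ (w l h) (w l' h') = inner ℂ h ((τ.chain l l' : H →L[ℂ] H) h')
  dense_w : Dense (Submodule.span ℂ (Set.range fun p : List A × H => w p.1 p.2) : Set K)
  L : Type u
  [normedAddCommGroupL : NormedAddCommGroup L]
  [innerProductSpaceL : InnerProductSpace ℂ L]
  [completeSpaceL : CompleteSpace L]
  e : A → H →L[ℂ] L
  inner_e : ∀ x y h h', inner ℂ (e x h) (e y h') =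
    inner ℂ h ((τ (star x * y) : H →L[ℂ] H) h')
  dense_e : Dense (Submodule.span ℂ (Set.range fun p : A × H => e p.1 p.2) : Set L)

namespace DilationSpaces

attribute [instance] normedAddCommGroupK innerProductSpaceK completeSpaceK normedAddCommGroupL
  innerProductSpaceL completeSpaceL

variable {H : Type u} [NormedAddCommGroup H] [InnerProductSpace ℂ H] [CompleteSpace H]
  {A : VonNeumannAlgebra H}

theorem nonempty (τ : NormalUCPMap A) : Nonempty (DilationSpaces τ) := by
  obtain ⟨K, _, _, _, w, hw, hwd⟩ := τ.isPositiveKernel_chain.exists_decomposition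
  obtain ⟨L, _, _, _, e, he, hed⟩ :=
    (τ.isPositiveKernel_chain.comp fun x : A => [x]).exists_decomposition
  exact ⟨{ K := K, w := w, inner_w := hw, dense_w := hwd, L := L, e := e, dense_e := hed,
           inner_e := fun x y h h' => by
             rw [he, NormalUCPMap.chain_cons_cons, NormalUCPMap.chain_nil_nil, mul_one] }⟩

variable {τ : NormalUCPMap A} (E : DilationSpaces τ)

/-- The trace in `K` of the fact that `θⁿ⁺¹(p)` fixes the vectors of words of length `n`. -/
theorem w_append_one (l : List A) : E.w (l ++ [1]) = E.w l := by
  ext h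
  refine eq_of_inner_total E.dense_w fun p => ?_
  rw [E.inner_w, E.inner_w, τ.chain_append_one_right]

theorem w_singleton_one : E.w [1] = E.w [] := E.w_append_one []

theorem exists_leftRep : ∃ π : A →⋆ₐ[ℂ] (E.L →L[ℂ] E.L), ∀ a x h, π a (E.e x h) = E.e (a * x) h := by
  let g : A →ₗ[ℂ] (A × H → E.L) :=
    { toFun := fun a p => E.e (a * p.1) p.2
      map_add' := fun a b => by
        ext p
        refine eq_of_inner_total E.dense_e fun q => ?_
        simp only [Pi.add_apply, inner_add_right, E.inner_e, add_mul, mul_add, map_add]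
        rw [← inner_add_right]
        rfl
      map_smul' := fun c a => by
        ext p
        refine eq_of_inner_total E.dense_e fun q => ?_
        simp only [Pi.smul_apply, RingHom.id_apply, inner_smul_right, E.inner_e, smul_mul_assoc,
          mul_smul_comm, map_smul]
        rw [← inner_smul_right]
        rfl }
  have h1 : g 1 = fun p => E.e p.1 p.2 := by
    ext p
    simp [g]
  obtain ⟨π, hπ⟩ := exists_starAlgHom_of_inner_eq g (by rw [h1]; exact E.dense_e)
    fun b c p q => by
      change inner ℂ (E.e (b * p.1) p.2) (E.e (c * q.1) q.2) =
        inner ℂ (E.e (1 * p.1) p.2) (E.e (star b * c * q.1) q.2)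
      rw [E.inner_e, E.inner_e]
      simp only [star_mul, mul_assoc, one_mul]
  refine ⟨π, fun a x h => ?_⟩
  have := hπ a (x, h)
  rwa [h1] at this

/-- The Stinespring representation of `A`. -/
noncomputable def leftRep : A →⋆ₐ[ℂ] (E.L →L[ℂ] E.L) := E.exists_leftRep.choose

theorem leftRep_apply (a x : A) (h : H) : E.leftRep a (E.e x h) = E.e (a * x) h :=
  E.exists_leftRep.choose_spec a x h

/-- The functional is `a ↦ ⟨h, τ(x* a x) h⟩`, and both `a ↦ x* a x` and `τ` preserve suprema. Here
the normality of `τ` enters the construction. -/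
theorem isNormalFunctional_leftRep (x : A) (h : H) :
    IsNormalFunctional (vectorFunctional E.leftRep (E.e x h)) := by
  intro S hne hpos hdir z hz
  have := hne.to_subtype
  have := hdir.isDirectedOrder
  have hconj : ∀ a b : A, a ≤ b → star x * a * x ≤ star x * b * x :=
    fun a b hab => star_left_conjugate_le_conjugate hab x
  let s : S → A := fun a => star x * a * x
  have hs : Monotone s := fun a b hab => hconj a b hab
  have h1 : IsLUB (Set.range s) (star x * z * x) := by
    refine isLUB_range_of_tendsto hs fun k => ?_
    exact ((star x : A) : H →L[ℂ] H).continuous.tendsto _ |>.comp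
      (tendsto_of_isLUB hne hdir hz ((x : H →L[ℂ] H) k))
  have h2 := τ.normal' (Set.range s) (Set.range_nonempty s) (by
      rintro _ ⟨a, rfl⟩
      exact IsSelfAdjoint.of_nonneg (star_left_conjugate_nonneg (hpos a a.2) x))
    (by
      rintro _ ⟨a, rfl⟩ _ ⟨b, rfl⟩
      obtain ⟨c, hac, hbc⟩ := exists_ge_ge a b
      exact ⟨_, ⟨c, rfl⟩, hs hac, hs hbc⟩) _ h1
  rw [← Set.range_comp] at h2
  have hτ : Monotone τ := fun a b hab =>
    OrderHomClass.mono τ.toCompletelyPositiveMap hab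
  have h3 := tendsto_of_isLUB_range (s := fun a => τ (s a)) (fun a b hab => hτ (hs hab)) h2 h
  have h4 : ∀ a : A, vectorFunctional E.leftRep (E.e x h) a =
      (inner ℂ h ((τ (star x * a * x) : H →L[ℂ] H) h)).re := by
    intro a
    change (inner ℂ (E.leftRep a (E.e x h)) (E.e x h)).re = _
    rw [leftRep_apply, ← inner_conj_symm, E.inner_e, Complex.conj_re, mul_assoc]
  simp only [h4]
  exact (Complex.continuous_re.tendsto _).comp (tendsto_const_nhds.inner h3)

/-- The operator `x ⊗ h ↦ l ⊗ x ⊗ h`. -/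
theorem exists_creation (l : List A) :
    ∃ Γ : E.L →L[ℂ] E.K, ∀ x h, Γ (E.e x h) = E.w (x :: l) h := by
  obtain ⟨T, hT⟩ := exists_clm_of_inner_eq (g := fun p : A × H => E.w (p.1 :: l) p.2) E.dense_e
    (E.leftRep (τ.chain l l)) fun p q => by
      rw [E.inner_w, leftRep_apply, E.inner_e, NormalUCPMap.chain_cons_cons, mul_assoc]
  exact ⟨T, fun x h => hT (x, h)⟩

/-- The operator `x ⊗ h ↦ l ⊗ x ⊗ h` from the Stinespring space to the dilation space. -/
noncomputable def creation (l : List A) : E.L →L[ℂ] E.K := (E.exists_creation l).choose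

theorem creation_apply (l : List A) (x : A) (h : H) :
    E.creation l (E.e x h) = E.w (x :: l) h := (E.exists_creation l).choose_spec x h

theorem inner_creation (l l' : List A) (u v : E.L) :
    inner ℂ (E.creation l u) (E.creation l' v) = inner ℂ u (E.leftRep (τ.chain l l') v) := by
  have : (E.creation l).adjoint ∘L E.creation l' = E.leftRep (τ.chain l l') := by
    refine clm_eq_of_total E.dense_e fun p => eq_of_inner_total E.dense_e fun q => ?_
    rw [ContinuousLinearMap.comp_apply, ContinuousLinearMap.adjoint_inner_right, creation_apply,
      creation_apply, E.inner_w, leftRep_apply, E.inner_e, NormalUCPMap.chain_cons_cons, mul_assoc]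
  rw [← this, ContinuousLinearMap.comp_apply, ContinuousLinearMap.adjoint_inner_right]

/-- The representation of the commutant of `A` on the dilation space. -/
noncomputable def commRep : A.commutant →⋆ₐ[ℂ] (E.K →L[ℂ] E.K) :=
  (exists_commutant_representation E.inner_w E.dense_w).choose

theorem commRep_apply (a : A.commutant) (l : List A) (h : H) :
    E.commRep a (E.w l h) = E.w l ((a : H →L[ℂ] H) h) :=
  (exists_commutant_representation E.inner_w E.dense_w).choose_spec a l h

/-- The representation of the commutant of `A` on the Stinespring space. -/
noncomputable def commRepL : A.commutant →⋆ₐ[ℂ] (E.L →L[ℂ] E.L) :=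
  (exists_commutant_representation (k := fun x y => τ (star x * y)) E.inner_e E.dense_e).choose

theorem commRepL_apply (a : A.commutant) (x : A) (h : H) :
    E.commRepL a (E.e x h) = E.e x ((a : H →L[ℂ] H) h) :=
  (exists_commutant_representation (k := fun x y => τ (star x * y)) E.inner_e
    E.dense_e).choose_spec a x h

theorem commRep_creation (a : A.commutant) (l : List A) (u : E.L) :
    E.commRep a (E.creation l u) = E.creation l (E.commRepL a u) := by
  have : E.commRep a ∘L E.creation l = E.creation l ∘L E.commRepL a :=
    clm_eq_of_total E.dense_e fun p => by
      simp only [ContinuousLinearMap.comp_apply, creation_apply, commRepL_apply, commRep_apply]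
  exact congrArg (fun t : E.L →L[ℂ] E.K => t u) this

theorem commRepL_leftRep (a : A.commutant) (b : A) (u : E.L) :
    E.commRepL a (E.leftRep b u) = E.leftRep b (E.commRepL a u) := by
  have : E.commRepL a ∘L E.leftRep b = E.leftRep b ∘L E.commRepL a :=
    clm_eq_of_total E.dense_e fun p => by
      simp only [ContinuousLinearMap.comp_apply, leftRep_apply, commRepL_apply]
  exact congrArg (fun t : E.L →L[ℂ] E.L => t u) this

/-- The intertwiners between the identity and the Stinespring representation. -/
abbrev Intertwiner : Type u := {T : H →L[ℂ] E.L // IsIntertwiner E.leftRep T}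

variable {E}

/-! ### The operators `1 ⊗ T` on the dilation space -/

namespace Intertwiner

/-- `T* S` for intertwiners `T` and `S`. -/
noncomputable def gram (T S : E.Intertwiner) : A.commutant :=
  ⟨T.1.adjoint ∘L S.1, mem_commutant_iff.mpr fun a ha => by
    ext h
    refine ext_inner_left ℂ fun v => ?_
    change inner ℂ v (a (T.1.adjoint (S.1 h))) = inner ℂ v (T.1.adjoint (S.1 (a h)))
    rw [← a.adjoint_inner_left, T.1.adjoint_inner_right, T.1.adjoint_inner_right, S.2 ⟨a, ha⟩,
      ← (E.leftRep ⟨a, ha⟩).adjoint_inner_left, ← ContinuousLinearMap.star_eq_adjoint,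
      ← ContinuousLinearMap.star_eq_adjoint, ← map_star]
    exact congrArg (inner ℂ · _) (T.2 (star ⟨a, ha⟩) v)⟩

theorem inner_gram (T S : E.Intertwiner) (h h' : H) :
    inner ℂ h ((gram T S : H →L[ℂ] H) h') = inner ℂ (T.1 h) (S.1 h') := by
  change inner ℂ h (T.1.adjoint (S.1 h')) = _
  rw [ContinuousLinearMap.adjoint_inner_right]

/-- The intertwining property moves `chain l l' ∈ A` from `L` to `H`, where it commutes with `T* S ∈
A'`. -/
theorem inner_creation_apply (T S : E.Intertwiner) (l l' : List A) (h h' : H) :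
    inner ℂ (E.creation l (T.1 h)) (E.creation l' (S.1 h')) =
      inner ℂ (E.w l h) (E.commRep (gram T S) (E.w l' h')) := by
  rw [inner_creation, ← S.2, commRep_apply, E.inner_w, commutant_apply_comm, inner_gram]

theorem exists_shift (T : E.Intertwiner) :
    ∃ W : E.K →L[ℂ] E.K, ∀ l h, W (E.w l h) = E.creation l (T.1 h) := by
  obtain ⟨W, hW⟩ := exists_clm_of_inner_eq
    (g := fun p : List A × H => E.creation p.1 (T.1 p.2)) E.dense_w (E.commRep (gram T T))
    fun p q => inner_creation_apply T T p.1 q.1 p.2 q.2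
  exact ⟨W, fun l h => hW (l, h)⟩

/-- The operator `l ⊗ h ↦ l ⊗ T h` on the dilation space. -/
noncomputable def shift (T : E.Intertwiner) : E.K →L[ℂ] E.K := T.exists_shift.choose

theorem shift_apply (T : E.Intertwiner) (l : List A) (h : H) :
    T.shift (E.w l h) = E.creation l (T.1 h) := T.exists_shift.choose_spec l h

theorem inner_shift (T S : E.Intertwiner) (u v : E.K) :
    inner ℂ (T.shift u) (S.shift v) = inner ℂ u (E.commRep (gram T S) v) := by
  have : T.shift.adjoint ∘L S.shift = E.commRep (gram T S) := by
    refine clm_eq_of_total E.dense_w fun p => eq_of_inner_total E.dense_w fun q => ?_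
    rw [ContinuousLinearMap.comp_apply, ContinuousLinearMap.adjoint_inner_right, shift_apply,
      shift_apply, inner_creation_apply]
  rw [← this, ContinuousLinearMap.comp_apply, ContinuousLinearMap.adjoint_inner_right]

/-- The commutant of `A` acts on intertwiners by composition. -/
noncomputable def smul (a : A.commutant) (T : E.Intertwiner) : E.Intertwiner :=
  ⟨E.commRepL a ∘L T.1, fun b h => by
    rw [ContinuousLinearMap.comp_apply, T.2, commRepL_leftRep, ContinuousLinearMap.comp_apply]⟩

theorem commRep_shift (a : A.commutant) (T : E.Intertwiner) (u : E.K) :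
    E.commRep a (T.shift u) = (smul a T).shift u := by
  have : E.commRep a ∘L T.shift = (smul a T).shift :=
    clm_eq_of_total E.dense_w fun p => by
      rw [ContinuousLinearMap.comp_apply, shift_apply, shift_apply, commRep_creation]
      rfl
  exact congrArg (fun t : E.K →L[ℂ] E.K => t u) this

theorem dense_range : Dense (Submodule.span ℂ
    (Set.range fun p : E.Intertwiner × H => p.1.1 p.2) : Set E.L) := by
  convert dense_span_intertwiner E.leftRep E.dense_e fun p => E.isNormalFunctional_leftRep p.1 p.2
  ext k
  constructor
  · rintro ⟨p, rfl⟩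
    exact ⟨p.1.1, p.1.2, p.2, rfl⟩
  · rintro ⟨T, hT, h, rfl⟩
    exact ⟨(⟨T, hT⟩, h), rfl⟩

/-- Totality of the intertwiner ranges in `L` gives every vector `l ⊗ u`. The empty word is covered
too, because it equals the word `[1]`. -/
theorem dense_shift : Dense (Submodule.span ℂ
    (Set.range fun p : E.Intertwiner × E.K => p.1.shift p.2) : Set E.K) := by
  set N₀ := Submodule.span ℂ (Set.range fun p : E.Intertwiner × E.K => p.1.shift p.2)
  have hcl := Submodule.isClosed_topologicalClosure N₀
  have h1 : ∀ l u, E.creation l u ∈ N₀.topologicalClosure := by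
    intro l u
    have h2 : (⊤ : Submodule ℂ E.L) ≤
        N₀.topologicalClosure.comap (E.creation l : E.L →ₗ[ℂ] E.K) := by
      rw [← Submodule.dense_iff_topologicalClosure_eq_top.mp (dense_range (E := E))]
      refine Submodule.topologicalClosure_minimal _ (Submodule.span_le.mpr ?_)
        (hcl.preimage (E.creation l).continuous)
      rintro _ ⟨⟨T, h⟩, rfl⟩
      refine Submodule.le_topologicalClosure _ (Submodule.subset_span ⟨(T, E.w l h), ?_⟩)
      exact shift_apply T l h
    exact h2 trivial
  rw [Submodule.dense_iff_topologicalClosure_eq_top, eq_top_iff,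
    ← Submodule.dense_iff_topologicalClosure_eq_top.mp E.dense_w]
  refine Submodule.topologicalClosure_minimal _ (Submodule.span_le.mpr ?_) hcl
  rintro _ ⟨⟨l, h⟩, rfl⟩
  change E.w l h ∈ _
  cases l with
  | nil =>
    rw [← w_singleton_one, ← creation_apply]
    exact h1 _ _
  | cons x l =>
    rw [← creation_apply]
    exact h1 _ _

end Intertwiner

end DilationSpaces

theorem tendsto_apply_of_total {ι X K : Type*} [NormedAddCommGroup K] [InnerProductSpace ℂ K]
    {l : Filter ι} {T : ι → K →L[ℂ] K} {T₀ : K →L[ℂ] K} {f : X → K}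
    (hf : Dense (Submodule.span ℂ (Set.range f) : Set K)) (C : ℝ)
    (hC : ∀ᶠ i in l, ‖T i - T₀‖ ≤ C)
    (h : ∀ x, Tendsto (fun i => T i (f x)) l (𝓝 (T₀ (f x)))) (k : K) :
    Tendsto (fun i => T i k) l (𝓝 (T₀ k)) := by
  have hspan : ∀ k ∈ Submodule.span ℂ (Set.range f), Tendsto (fun i => T i k) l (𝓝 (T₀ k)) := by
    intro k hk
    induction hk using Submodule.span_induction with
    | mem k hk => obtain ⟨x, rfl⟩ := hk; exact h x
    | zero => simpa using tendsto_const_nhds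
    | add u v _ _ hu hv => simpa using hu.add hv
    | smul c u _ hu => simpa using hu.const_smul c
  rw [Metric.tendsto_nhds]
  intro ε hε
  have hC1 : 0 < |C| + 1 := by positivity
  obtain ⟨k', hk', hd⟩ := Metric.dense_iff.mp hf k (ε / (2 * (|C| + 1))) (by positivity)
  filter_upwards [hC, Metric.tendsto_nhds.mp (hspan k' hd) (ε / 2) (by positivity)] with i hi hi'
  have h1 : T i k - T₀ k = (T i - T₀) (k - k') + (T i k' - T₀ k') := by
    simp only [map_sub, sub_apply]
    abel
  rw [dist_eq_norm] at hi' ⊢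
  rw [h1]
  have h2 : ‖(T i - T₀) (k - k')‖ ≤ (|C| + 1) * ‖k - k'‖ :=
    ContinuousLinearMap.le_of_opNorm_le _ (by linarith [le_abs_self C]) _
  have h3 : (|C| + 1) * ‖k - k'‖ < ε / 2 := by
    rw [Metric.mem_ball, dist_eq_norm, norm_sub_rev, lt_div_iff₀ (by positivity)] at hk'
    linarith
  linarith [norm_add_le ((T i - T₀) (k - k')) (T i k' - T₀ k')]

namespace NormalUCPMap

variable {H : Type u} [NormedAddCommGroup H] [InnerProductSpace ℂ H] [CompleteSpace H]
  {A : VonNeumannAlgebra H} (τ : NormalUCPMap A)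

theorem chain_nil_cons (y : A) (l : List A) : τ.chain [] (y :: l) = τ (τ.chain [] l * y) := by
  rw [chain]

theorem chain_nil_replicate (n : ℕ) (a : A) :
    τ.chain [] (List.replicate n 1 ++ [a]) = τ^[n + 1] a := by
  induction n with
  | zero =>
    rw [List.replicate_zero, List.nil_append, chain_nil_cons, chain_nil_nil, one_mul]
    rfl
  | succ n ih =>
    rw [List.replicate_succ, List.cons_append, chain_nil_cons, ih, mul_one]
    exact (Function.iterate_succ_apply' _ _ _).symm

end NormalUCPMap

/-! ### The endomorphism `b ↦ b ⊗ 1` and its action on words -/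

namespace DilationSpaces

variable {H : Type u} [NormedAddCommGroup H] [InnerProductSpace ℂ H] [CompleteSpace H]
  {A : VonNeumannAlgebra H} {τ : NormalUCPMap A} (E : DilationSpaces τ)

/-- The commutant of the action of `A'` on the dilation space. -/
noncomputable def ambient : VonNeumannAlgebra E.K :=
  ofCentralizer (Set.range E.commRep) (by rintro _ ⟨a, rfl⟩; exact ⟨star a, map_star _ _⟩)

theorem mem_ambient_iff {b : E.K →L[ℂ] E.K} :
    b ∈ E.ambient ↔ ∀ a k, E.commRep a (b k) = b (E.commRep a k) := by
  rw [← SetLike.mem_coe, ambient, coe_ofCentralizer, Set.mem_centralizer_iff, Set.forall_mem_range]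
  exact forall_congr' fun a => ContinuousLinearMap.ext_iff

/-- The Gram kernel of the vectors `(1 ⊗ T) b k` is governed by `T* S ∈ A'`, whose action on `K`
commutes with `b`; hence `b` may be moved across the inner product as `b*`. -/
theorem exists_endo : ∃ Θ : E.ambient →⋆ₐ[ℂ] (E.K →L[ℂ] E.K),
    ∀ b (T : E.Intertwiner) k, Θ b (T.shift k) = T.shift ((b : E.K →L[ℂ] E.K) k) := by
  let g : E.ambient →ₗ[ℂ] (E.Intertwiner × E.K → E.K) :=
    { toFun := fun b p => p.1.shift ((b : E.K →L[ℂ] E.K) p.2)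
      map_add' := fun a b => by ext p; simp
      map_smul' := fun c a => by
        ext p
        exact map_smul p.1.shift c ((a : E.K →L[ℂ] E.K) p.2) }
  obtain ⟨Θ, hΘ⟩ := exists_starAlgHom_of_inner_eq g Intertwiner.dense_shift fun b c p q => by
    change inner ℂ (p.1.shift ((b : E.K →L[ℂ] E.K) p.2)) (q.1.shift ((c : E.K →L[ℂ] E.K) q.2)) =
      inner ℂ (p.1.shift p.2)
        (q.1.shift ((star (b : E.K →L[ℂ] E.K)) ((c : E.K →L[ℂ] E.K) q.2)))
    have h1 : star (b : E.K →L[ℂ] E.K) ∈ E.ambient := star_mem b.2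
    rw [Intertwiner.inner_shift, Intertwiner.inner_shift, E.mem_ambient_iff.mp h1,
      ContinuousLinearMap.star_eq_adjoint, ContinuousLinearMap.adjoint_inner_right]
  exact ⟨Θ, fun b T k => hΘ b (T, k)⟩

/-- The endomorphism `b ↦ b ⊗ 1`, with values in the bounded operators. -/
noncomputable def endoHom : E.ambient →⋆ₐ[ℂ] (E.K →L[ℂ] E.K) := E.exists_endo.choose

theorem endoHom_shift (b : E.ambient) (T : E.Intertwiner) (k : E.K) :
    E.endoHom b (T.shift k) = T.shift ((b : E.K →L[ℂ] E.K) k) := E.exists_endo.choose_spec b T k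

/-- The commutant `A'` maps an operator `1 ⊗ T` to another such operator, `1 ⊗ (a T)`, and `Θ b`
acts on all of them by the same rule. -/
theorem endoHom_mem (b : E.ambient) : E.endoHom b ∈ E.ambient := by
  rw [mem_ambient_iff]
  intro a k
  have : E.commRep a ∘L E.endoHom b = E.endoHom b ∘L E.commRep a :=
    clm_eq_of_total Intertwiner.dense_shift fun p => by
      rw [ContinuousLinearMap.comp_apply, ContinuousLinearMap.comp_apply, endoHom_shift,
        Intertwiner.commRep_shift, Intertwiner.commRep_shift, endoHom_shift]
  exact congrArg (fun t : E.K →L[ℂ] E.K => t k) this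

/-- The endomorphism `b ↦ b ⊗ 1` of the commutant of `A'`. -/
noncomputable def endo : E.ambient →⋆ₐ[ℂ] E.ambient :=
  E.endoHom.codRestrict E.ambient.toStarSubalgebra E.endoHom_mem

theorem coe_endo (b : E.ambient) : (E.endo b : E.K →L[ℂ] E.K) = E.endoHom b := rfl

/-- The embedding of `H` as the vectors of the empty word. -/
noncomputable def incl : H →ₗᵢ[ℂ] E.K where
  toLinearMap := (E.w []).toLinearMap
  norm_map' h := by
    have h1 := E.inner_w [] [] h h
    rw [τ.chain_nil_nil] at h1
    have h2 : ‖E.w [] h‖ ^ 2 = ‖h‖ ^ 2 := by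
      rw [← inner_self_eq_norm_sq (𝕜 := ℂ), h1, ← inner_self_eq_norm_sq (𝕜 := ℂ)]
      rfl
    exact (sq_eq_sq₀ (norm_nonneg _) (norm_nonneg _)).mp h2

theorem incl_apply (h : H) : E.incl h = E.w [] h := rfl

theorem adjoint_incl_commRep (a : A.commutant) (k : E.K) :
    E.incl.toContinuousLinearMap.adjoint (E.commRep a k) =
      (a : H →L[ℂ] H) (E.incl.toContinuousLinearMap.adjoint k) := by
  refine ext_inner_left ℂ fun h => ?_
  rw [ContinuousLinearMap.adjoint_inner_right, ← ContinuousLinearMap.adjoint_inner_left,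
    ← (a : H →L[ℂ] H).adjoint_inner_left, ContinuousLinearMap.adjoint_inner_right,
    ← ContinuousLinearMap.star_eq_adjoint, ← ContinuousLinearMap.star_eq_adjoint, ← map_star]
  exact congrArg (inner ℂ · k) (E.commRep_apply (star a) [] h)

theorem adjoint_incl_incl (h : H) : E.incl.toContinuousLinearMap.adjoint (E.incl h) = h := by
  refine ext_inner_left ℂ fun v => ?_
  rw [ContinuousLinearMap.adjoint_inner_right]
  exact E.incl.inner_map_map v h

theorem extendOp_apply (a : A) (k : E.K) : extendOp E.incl a k =
    E.incl ((a : H →L[ℂ] H) (E.incl.toContinuousLinearMap.adjoint k)) := rfl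

theorem extendOp_mem_ambient (a : A) : extendOp E.incl a ∈ E.ambient := by
  rw [mem_ambient_iff]
  intro b k
  rw [extendOp_apply, extendOp_apply, adjoint_incl_commRep, incl_apply, commRep_apply,
    commutant_apply_comm, incl_apply]

/-- `A` as a corner of the ambient algebra. -/
noncomputable def extend (a : A) : E.ambient := ⟨extendOp E.incl a, E.extendOp_mem_ambient a⟩

theorem extend_incl (a : A) (h : H) :
    (E.extend a : E.K →L[ℂ] E.K) (E.w [] h) = E.w [] ((a : H →L[ℂ] H) h) := by
  change extendOp E.incl a (E.incl h) = _
  rw [extendOp_apply, adjoint_incl_incl]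
  rfl

theorem star_extend (a : A) : star (E.extend a) = E.extend (star a) := by
  apply Subtype.ext
  change star (extendOp E.incl a) = extendOp E.incl (star (a : H →L[ℂ] H))
  simp only [extendOp, ContinuousLinearMap.star_eq_adjoint, ContinuousLinearMap.adjoint_comp,
    ContinuousLinearMap.adjoint_adjoint]
  rfl

/-- The embedding of `H` intertwines the two actions of `A'`, so the compression commutes with `A'`
and lies in `A'' = A`. -/
theorem compressOp_mem {b : E.K →L[ℂ] E.K} (hb : b ∈ E.ambient) : compressOp E.incl b ∈ A := by
  suffices h : compressOp E.incl b ∈ A.commutant.commutant by rwa [A.commutant_commutant] at h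
  rw [mem_commutant_iff]
  intro a ha
  ext h
  change a (E.incl.toContinuousLinearMap.adjoint (b (E.incl h))) =
    E.incl.toContinuousLinearMap.adjoint (b (E.incl (a h)))
  have h1 := E.adjoint_incl_commRep ⟨a, ha⟩ (b (E.incl h))
  rw [E.mem_ambient_iff.mp hb, incl_apply, commRep_apply] at h1
  exact h1.symm

/-- On ranges of intertwiners, `(1 ⊗ T) a h` is the word-level image of `T (a h) = π(a) T h`; so on
one-letter words `θ(a)` is the left action of `A` on `L`. -/
theorem endo_extend_apply (a x : A) (h : H) :
    (E.endo (E.extend a) : E.K →L[ℂ] E.K) (E.w [x] h) = E.w [a * x] h := by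
  have : E.endoHom (E.extend a) ∘L E.creation [] = E.creation [] ∘L E.leftRep a :=
    clm_eq_of_total Intertwiner.dense_range fun p => by
      rw [ContinuousLinearMap.comp_apply, ContinuousLinearMap.comp_apply,
        ← Intertwiner.shift_apply, endoHom_shift, extend_incl, Intertwiner.shift_apply, p.1.2]
  have h1 := congrArg (fun t : E.L →L[ℂ] E.K => t (E.e x h)) this
  simp only [ContinuousLinearMap.comp_apply, leftRep_apply, creation_apply] at h1
  exact h1

/-- The head of a list is the letter next to `h`: `b ⊗ 1` leaves it alone and lets `b` act on the
tail. -/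
theorem endo_apply_cons {b : E.ambient} {l l' : List A}
    (hb : ∀ h, (b : E.K →L[ℂ] E.K) (E.w l h) = E.w l' h) (x : A) (h : H) :
    (E.endo b : E.K →L[ℂ] E.K) (E.w (x :: l) h) = E.w (x :: l') h := by
  have : E.endoHom b ∘L E.creation l = E.creation l' :=
    clm_eq_of_total Intertwiner.dense_range fun p => by
      rw [ContinuousLinearMap.comp_apply, ← Intertwiner.shift_apply, endoHom_shift, hb,
        Intertwiner.shift_apply]
  have h1 := congrArg (fun t : E.L →L[ℂ] E.K => t (E.e x h)) this
  simp only [ContinuousLinearMap.comp_apply, creation_apply] at h1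
  exact h1

theorem endo_iterate_apply (a x : A) (l : List A) (h : H) :
    (E.endo^[l.length + 1] (E.extend a) : E.K →L[ℂ] E.K) (E.w (l ++ [x]) h) =
      E.w (l ++ [a * x]) h := by
  induction l generalizing h with
  | nil => exact E.endo_extend_apply a x h
  | cons y l ih =>
    rw [List.length_cons, Function.iterate_succ_apply']
    exact E.endo_apply_cons ih y h

/-- Padding by `1` supplies the letter at position `l.length + 1` that `a` multiplies. -/
theorem endo_iterate_apply_word (a : A) (l : List A) (h : H) :
    (E.endo^[l.length + 1] (E.extend a) : E.K →L[ℂ] E.K) (E.w l h) = E.w (l ++ [a]) h := by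
  rw [← w_append_one, endo_iterate_apply, mul_one]

theorem compressOp_endo_iterate (n : ℕ) (a : A) :
    compressOp E.incl (E.endo^[n] (E.extend a)) = (τ^[n] a : A) := by
  ext h
  refine ext_inner_left ℂ fun v => ?_
  change inner ℂ v (E.incl.toContinuousLinearMap.adjoint
    ((E.endo^[n] (E.extend a) : E.K →L[ℂ] E.K) (E.incl h))) = _
  rw [ContinuousLinearMap.adjoint_inner_right]
  change inner ℂ (E.w [] v) ((E.endo^[n] (E.extend a) : E.K →L[ℂ] E.K) (E.w [] h)) = _
  cases n with
  | zero =>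
    rw [Function.iterate_zero_apply, extend_incl, E.inner_w, τ.chain_nil_nil]
    rfl
  | succ n =>
    -- The empty word is padded to length `n`, so that `θⁿ⁺¹(a)` appends the letter `a` to it.
    have h1 : E.w [] = E.w (List.replicate n 1) := by
      induction n with
      | zero => rfl
      | succ n ih => rw [List.replicate_succ', w_append_one, ih]
    have h3 := E.endo_iterate_apply_word a (List.replicate n 1) h
    rw [List.length_replicate, ← h1] at h3
    rw [h3, E.inner_w, τ.chain_nil_replicate]

/-! ### The generated algebra and the minimal dilation -/

/-- The set of all `θⁿ(a)`. -/
def generators : Set (E.K →L[ℂ] E.K) :=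
  {b | ∃ (n : ℕ) (a : A), b = (E.endo^[n] (E.extend a) : E.ambient)}

theorem endo_iterate_star (n : ℕ) (b : E.ambient) : star (E.endo^[n] b) = E.endo^[n] (star b) := by
  induction n with
  | zero => rfl
  | succ n ih => rw [Function.iterate_succ_apply', Function.iterate_succ_apply', ← map_star, ih]

theorem star_mem_generators : ∀ b ∈ E.generators, star b ∈ E.generators := by
  rintro _ ⟨n, a, rfl⟩
  refine ⟨n, star a, ?_⟩
  rw [← star_extend, ← endo_iterate_star]
  rfl

/-- The von Neumann algebra generated by all `θⁿ(a)`. -/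
noncomputable def algebra : VonNeumannAlgebra E.K :=
  ofCentralizer (Set.centralizer E.generators)
    fun _ => Set.star_mem_centralizer' E.star_mem_generators

theorem coe_algebra : (E.algebra : Set (E.K →L[ℂ] E.K)) =
    Set.centralizer (Set.centralizer E.generators) := rfl

theorem generators_subset_algebra : E.generators ⊆ E.algebra :=
  Set.subset_centralizer_centralizer

theorem algebra_le_ambient {b : E.K →L[ℂ] E.K} (hb : b ∈ E.algebra) : b ∈ E.ambient := by
  rw [← SetLike.mem_coe, coe_algebra] at hb
  rw [mem_ambient_iff]
  intro a k
  refine congrArg (fun t : E.K →L[ℂ] E.K => t k) (hb (E.commRep a) ?_)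
  rintro _ ⟨n, x, rfl⟩
  ext k
  exact (E.mem_ambient_iff.mp (E.endo^[n] (E.extend x)).2 a k).symm

theorem inner_endoHom (b : E.ambient) (u v : E.K) :
    inner ℂ u (E.endoHom b v) = inner ℂ (E.endoHom (star b) u) v := by
  rw [map_star, ContinuousLinearMap.star_eq_adjoint, ContinuousLinearMap.adjoint_inner_left]

theorem inner_ambient (b : E.ambient) (u v : E.K) :
    inner ℂ u ((b : E.K →L[ℂ] E.K) v) =
      inner ℂ (((star b : E.ambient) : E.K →L[ℂ] E.K) u) v := by
  change _ = inner ℂ ((star (b : E.K →L[ℂ] E.K)) u) v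
  rw [ContinuousLinearMap.star_eq_adjoint, ContinuousLinearMap.adjoint_inner_left]

theorem endo_generators {b : E.ambient} (hb : (b : E.K →L[ℂ] E.K) ∈ E.generators) :
    E.endoHom b ∈ E.generators := by
  obtain ⟨n, a, h⟩ := hb
  refine ⟨n + 1, a, ?_⟩
  rw [Function.iterate_succ_apply', ← coe_endo, Subtype.ext h]

/-- For `c` commuting with the image of `b` under the endomorphism, `T* c S` commutes with `b`. -/
theorem shift_adjoint_comm {b : E.ambient} {c : E.K →L[ℂ] E.K}
    (hc : E.endoHom b * c = c * E.endoHom b) (T S : E.Intertwiner) :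
    (b : E.K →L[ℂ] E.K) * (T.shift.adjoint ∘L c ∘L S.shift) =
      (T.shift.adjoint ∘L c ∘L S.shift) * (b : E.K →L[ℂ] E.K) := by
  ext v
  refine ext_inner_left ℂ fun u => ?_
  change inner ℂ u ((b : E.K →L[ℂ] E.K) (T.shift.adjoint (c (S.shift v)))) =
    inner ℂ u (T.shift.adjoint (c (S.shift ((b : E.K →L[ℂ] E.K) v))))
  rw [inner_ambient, ContinuousLinearMap.adjoint_inner_right,
    ContinuousLinearMap.adjoint_inner_right, ← endoHom_shift, ← endoHom_shift, ← inner_endoHom]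
  exact congrArg (fun t : E.K →L[ℂ] E.K => inner ℂ (T.shift u) (t (S.shift v))) hc

/-- Let `c` commute with all generators. As `θ` maps generators to generators, every `(1 ⊗ T)* c (1
⊗ S)` commutes with the generators, hence with `b`. Read as matrix coefficients on the total set of
vectors `(1 ⊗ S) k`, this says that `c` commutes with `θ(b)`. -/
theorem endoHom_mem_algebra (b : E.ambient) (hb : (b : E.K →L[ℂ] E.K) ∈ E.algebra) :
    E.endoHom b ∈ E.algebra := by
  rw [← SetLike.mem_coe, coe_algebra, Set.mem_centralizer_iff]
  intro c hc
  have h1 : ∀ T S : E.Intertwiner,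
      (T.shift.adjoint ∘L c ∘L S.shift) ∈ Set.centralizer E.generators := by
    rintro T S _ ⟨n, a, rfl⟩
    exact E.shift_adjoint_comm (hc _ (E.endo_generators ⟨n, a, rfl⟩)) T S
  refine clm_eq_of_total Intertwiner.dense_shift fun p =>
    eq_of_inner_total Intertwiner.dense_shift fun q => ?_
  have h2 := congrArg (fun t : E.K →L[ℂ] E.K => inner ℂ q.2 (t p.2)) (hb _ (h1 q.1 p.1))
  change inner ℂ q.2 (q.1.shift.adjoint (c (p.1.shift ((b : E.K →L[ℂ] E.K) p.2)))) =
    inner ℂ q.2 ((b : E.K →L[ℂ] E.K) (q.1.shift.adjoint (c (p.1.shift p.2)))) at h2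
  change inner ℂ (q.1.shift q.2) (c (E.endoHom b (p.1.shift p.2))) =
    inner ℂ (q.1.shift q.2) (E.endoHom b (c (p.1.shift p.2)))
  rw [inner_ambient, ContinuousLinearMap.adjoint_inner_right,
    ContinuousLinearMap.adjoint_inner_right] at h2
  rw [endoHom_shift, h2, inner_endoHom, endoHom_shift]

/-- The inclusion of the generated algebra into the ambient algebra. -/
noncomputable def toAmbient : E.algebra →⋆ₐ[ℂ] E.ambient :=
  E.algebra.toStarSubalgebra.subtype.codRestrict E.ambient.toStarSubalgebra
    fun b => E.algebra_le_ambient b.2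

theorem coe_toAmbient (b : E.algebra) : (E.toAmbient b : E.K →L[ℂ] E.K) = b := rfl

/-- The endomorphism of the dilation. -/
noncomputable def theta : E.algebra →⋆ₐ[ℂ] E.algebra :=
  (E.endoHom.comp E.toAmbient).codRestrict E.algebra.toStarSubalgebra
    fun b => E.endoHom_mem_algebra (E.toAmbient b) b.2

theorem toAmbient_theta (b : E.algebra) : E.toAmbient (E.theta b) = E.endo (E.toAmbient b) := rfl

theorem coe_theta_iterate (n : ℕ) (b : E.algebra) :
    (E.theta^[n] b : E.K →L[ℂ] E.K) = (E.endo^[n] (E.toAmbient b) : E.ambient) := by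
  rw [← coe_toAmbient]
  congr 1
  induction n generalizing b with
  | zero => rfl
  | succ n ih => rw [Function.iterate_succ_apply, Function.iterate_succ_apply, ih, toAmbient_theta]

/-- Suprema are strong limits. On vectors `(1 ⊗ T) k` the operator `θ(b)` acts through `b` itself,
so strong convergence is inherited there. It spreads to `K` because the tail of the net beyond any
`s₀` is bounded. -/
theorem isNormalMap_theta : IsNormalMap E.theta := by
  intro S hne _ hdir x hx
  have := hne.to_subtype
  have := hdir.isDirectedOrder
  have hmono : Monotone E.theta := fun a b hab => OrderHomClass.mono E.theta hab
  have hstrong := fun k => tendsto_of_isLUB hne hdir hx k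
  rw [Set.image_eq_range]
  refine isLUB_range_of_tendsto (s := fun s : S => E.theta s) (fun a b hab => hmono hab) fun k => ?_
  obtain ⟨s₀⟩ := ‹Nonempty S›
  refine tendsto_apply_of_total Intertwiner.dense_shift
    ‖(E.theta x : E.K →L[ℂ] E.K) - E.theta s₀‖ ?_ (fun p => ?_) k
  · filter_upwards [eventually_ge_atTop s₀] with s hs
    rw [norm_sub_rev]
    exact CStarAlgebra.norm_le_norm_of_nonneg_of_le
      (sub_nonneg.mpr (show (E.theta s : E.K →L[ℂ] E.K) ≤ E.theta x from hmono (hx.1 s.2)))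
      (sub_le_sub_left (show (E.theta s₀ : E.K →L[ℂ] E.K) ≤ E.theta s from hmono hs) _)
  · have h1 : ∀ b : E.algebra, (E.theta b : E.K →L[ℂ] E.K) (p.1.shift p.2) =
        p.1.shift ((b : E.K →L[ℂ] E.K) p.2) := fun b => E.endoHom_shift (E.toAmbient b) p.1 p.2
    simp only [h1]
    exact (p.1.shift.continuous.tendsto _).comp (hstrong p.2)

theorem extendOp_mem_algebra (a : A) : extendOp E.incl a ∈ E.algebra :=
  E.generators_subset_algebra ⟨0, a, rfl⟩

theorem dilationWord_apply (x : ℕ → A) (n : ℕ) (h : H) :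
    ((dilationWord E.theta (fun j => ⟨extendOp E.incl (x j), E.extendOp_mem_algebra (x j)⟩) n :
      E.algebra) : E.K →L[ℂ] E.K) (E.incl h) = E.w ((List.range n).map fun j => x (j + 1)) h := by
  induction n with
  | zero => rfl
  | succ n ih =>
    rw [dilationWord]
    change ((E.theta^[n + 1] _ : E.algebra) : E.K →L[ℂ] E.K)
      (((dilationWord E.theta _ n : E.algebra) : E.K →L[ℂ] E.K) _) = _
    rw [ih, coe_theta_iterate, List.range_succ, List.map_append]
    have h1 := E.endo_iterate_apply_word (x (n + 1)) ((List.range n).map fun j => x (j + 1)) h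
    rw [List.length_map, List.length_range] at h1
    exact h1

/-- The minimal dilation. -/
noncomputable def minimalDilation : MinimalDilation τ where
  K := E.K
  incl := E.incl
  B := E.algebra
  extend_mem := E.extendOp_mem_algebra
  compress_mem b := E.compressOp_mem (E.algebra_le_ambient b.2)
  θ := E.theta
  normal := E.isNormalMap_theta
  dilation n a := by
    rw [coe_theta_iterate]
    exact E.compressOp_endo_iterate n a
  minimal_space := by
    refine E.dense_w.mono (Submodule.span_mono ?_)
    rintro _ ⟨⟨l, h⟩, rfl⟩
    -- A dilation word of length `n` uses `x 1, …, x n`, hence the index `j - 1`; neither `x 0` nor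
    -- the default `1` matters.
    refine ⟨l.length, fun j => l.getD (j - 1) 1, h, ?_⟩
    have h1 : ((List.range l.length).map fun j => l.getD (j + 1 - 1) 1) = l :=
      List.ext_getElem (by simp) fun i h1 h2 => by simp [List.getElem?_eq_getElem h2]
    rw [E.dilationWord_apply, h1]
  minimal_algebra := by
    rw [coe_algebra, generators]
    simp only [coe_theta_iterate]
    rfl

end DilationSpaces

/-! ### The automorphism of the peripheral Poisson boundary -/

theorem map_mem_peripheralSubalgebra {C : Type*} [CStarAlgebra C] (φ : C →⋆ₐ[ℂ] C) {y : C}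
    (hy : y ∈ peripheralSubalgebra φ) : φ y ∈ peripheralSubalgebra φ := by
  have h1 : peripheralSpace (φ : C →ₗ[ℂ] C) ≤
      (peripheralSpace (φ : C →ₗ[ℂ] C)).comap (φ : C →ₗ[ℂ] C) := by
    refine Submodule.topologicalClosure_minimal _ (Submodule.span_le.mpr ?_) ?_
    · rintro x ⟨c, hc, hx⟩
      refine Submodule.le_topologicalClosure _ (Submodule.subset_span ⟨c, hc, ?_⟩)
      rw [hx, map_smul, hx]
    · exact (Submodule.isClosed_topologicalClosure
        (Submodule.span ℂ (peripheralEigenvectors (φ : C →ₗ[ℂ] C)))).preimage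
          (map_continuous φ)
  exact h1 hy

namespace MinimalDilation

variable {H : Type u} [NormedAddCommGroup H] [InnerProductSpace ℂ H] [CompleteSpace H]
  {A : VonNeumannAlgebra H} {τ : NormalUCPMap A} (D : MinimalDilation τ)

/-- Recurrence excludes a loss of norm: `θⁿ(y) → y` along a filter finer than `atTop`, while
`‖θⁿ(y)‖ ≤ ‖θ(y)‖` once `n ≥ 1`. -/
theorem norm_theta (y : D.B) (hy : y ∈ peripheralSubalgebra D.θ) : ‖D.θ y‖ = ‖y‖ := by
  refine le_antisymm (NonUnitalStarAlgHom.norm_apply_le D.θ y) ?_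
  obtain ⟨F, hF, hFle, hrec⟩ := D.exists_filter_recurrent
  refine le_of_tendsto (hrec y hy).norm ?_
  filter_upwards [hFle (eventually_ge_atTop 1)] with n hn
  obtain ⟨m, rfl⟩ := Nat.exists_eq_add_of_le' hn
  rw [Function.iterate_succ_apply]
  exact D.norm_iterate_le m _

/-- The restriction of `θ` to its peripheral Poisson boundary. -/
noncomputable def thetaRestrict : peripheralSubalgebra D.θ →⋆ₐ[ℂ] peripheralSubalgebra D.θ :=
  (D.θ.comp (peripheralSubalgebra D.θ).subtype).codRestrict (peripheralSubalgebra D.θ)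
    fun y => map_mem_peripheralSubalgebra D.θ y.2

theorem isometry_thetaRestrict : Isometry D.thetaRestrict :=
  AddMonoidHomClass.isometry_of_norm D.thetaRestrict fun y => D.norm_theta y y.2

/-- An isometry of a complete space has closed range, and a peripheral eigenvector `y` with
eigenvalue `c` is `θ(c⁻¹ y)`. -/
theorem thetaRestrict_surjective : Function.Surjective D.thetaRestrict := by
  have hiso : Isometry fun y : peripheralSubalgebra D.θ => D.θ y :=
    isometry_subtype_coe.comp D.isometry_thetaRestrict
  have hcl : IsClosed (Set.range fun y : peripheralSubalgebra D.θ => D.θ y) :=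
    hiso.isClosedEmbedding.isClosed_range
  have hsub : (Submodule.span ℂ (peripheralEigenvectors (D.θ : D.B →ₗ[ℂ] D.B)) : Set D.B) ⊆
      Set.range fun y : peripheralSubalgebra D.θ => D.θ y := by
    intro y hy
    induction (show y ∈ Submodule.span ℂ _ from hy) using Submodule.span_induction with
    | mem y hw =>
      have hw' := hw
      obtain ⟨c, hc, hw⟩ := hw
      have hc0 : c ≠ 0 := by
        rintro rfl
        simp at hc
      have hyP : y ∈ peripheralSubalgebra D.θ :=
        Submodule.le_topologicalClosure _ (Submodule.subset_span hw')
      refine ⟨⟨c⁻¹ • y, (peripheralSubalgebra D.θ).smul_mem hyP _⟩, ?_⟩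
      have hw' : D.θ y = c • y := hw
      change D.θ (c⁻¹ • y) = y
      rw [map_smul, hw', smul_smul, inv_mul_cancel₀ hc0, one_smul]
    | zero => exact ⟨0, map_zero D.θ⟩
    | add x y hx' hy' h1 h2 =>
      obtain ⟨a, ha⟩ := h1 hx'
      obtain ⟨b, hb⟩ := h2 hy'
      exact ⟨a + b, by rw [← ha, ← hb]; exact map_add D.θ _ _⟩
    | smul c x hx' h =>
      obtain ⟨a, ha⟩ := h hx'
      exact ⟨c • a, by rw [← ha]; exact map_smul D.θ _ _⟩
  intro y
  obtain ⟨z, hz⟩ := closure_minimal hsub hcl y.2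
  exact ⟨z, Subtype.ext hz⟩

/-- The compression `P(θ) → P(τ)` as a *-isomorphism. -/
noncomputable def compressStarEquiv : peripheralSubalgebra D.θ ≃⋆ₐ[ℂ] D.Boundary :=
  StarAlgEquiv.symm
    { D.compressEquiv.symm.toLinearEquiv.toEquiv with
      map_mul' := Boundary.symm_mul D
      map_add' := map_add D.compressEquiv.symm
      map_star' := Boundary.symm_star D
      map_smul' := map_smul D.compressEquiv.symm }

theorem coe_compressStarEquiv (y : peripheralSubalgebra D.θ) :
    ((D.compressStarEquiv y : D.Boundary) : A) = D.compress y := rfl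

/-- The automorphism of `(P(τ), ∘)` induced by `τ`. -/
noncomputable def boundaryAut : D.Boundary ≃⋆ₐ[ℂ] D.Boundary :=
  (D.compressStarEquiv.symm.trans (StarAlgEquiv.ofBijective D.thetaRestrict
    ⟨D.isometry_thetaRestrict.injective, D.thetaRestrict_surjective⟩)).trans D.compressStarEquiv

theorem coe_boundaryAut (x : D.Boundary) : ((D.boundaryAut x : D.Boundary) : A) = τ (x : A) := by
  change D.compress (D.θ (D.compressStarEquiv.symm x : D.B)) = _
  rw [compress_theta, ← coe_compressStarEquiv, StarAlgEquiv.apply_symm_apply]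

/-- The inclusion `P(τ) → A` as a linear isometry. -/
noncomputable def boundaryIncl : D.Boundary →ₗᵢ[ℂ] A := D.boundarySpace.subtypeₗᵢ

theorem peripheralSubalgebra_boundaryAut :
    peripheralSubalgebra (D.boundaryAut : D.Boundary →⋆ₐ[ℂ] D.Boundary) = ⊤ := by
  rw [eq_top_iff]
  intro x _
  change x ∈ closure (Submodule.span ℂ (peripheralEigenvectors
    ((D.boundaryAut : D.Boundary →⋆ₐ[ℂ] D.Boundary) : D.Boundary →ₗ[ℂ] D.Boundary)) :
      Set D.Boundary)
  -- The boundary carries the norm of `A`, so the closure may be computed in `A`, where `P(τ)` is by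
  -- definition the closed span of the eigenvectors of `τ`.
  rw [D.boundaryIncl.isometry.isUniformInducing.isInducing.closure_eq_preimage_closure_image]
  refine closure_mono ?_ (show D.boundaryIncl x ∈ closure (Submodule.span ℂ
    (peripheralEigenvectors τ.toLinearMap) : Set A) from x.2)
  have h1 := Submodule.map_span D.boundaryIncl.toLinearMap (peripheralEigenvectors
    ((D.boundaryAut : D.Boundary →⋆ₐ[ℂ] D.Boundary) : D.Boundary →ₗ[ℂ] D.Boundary))
  refine (Submodule.span_mono ?_).trans h1.ge
  rintro y ⟨c, hc, hy⟩
  refine ⟨⟨y, Submodule.le_topologicalClosure _ (Submodule.subset_span ⟨c, hc, hy⟩)⟩,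
    ⟨c, hc, Subtype.ext ?_⟩, rfl⟩
  exact (D.coe_boundaryAut _).trans hy

end MinimalDilation

theorem theorem2p10 {H : Type u} [NormedAddCommGroup H] [InnerProductSpace ℂ H] [CompleteSpace H]
    {A : VonNeumannAlgebra H} (τ : NormalUCPMap A) :
    Nonempty (MinimalDilation τ) ∧
    ∀ D : MinimalDilation τ, ∃ α : D.Boundary ≃⋆ₐ[ℂ] D.Boundary,
      (∀ x : D.Boundary, ((α x : D.Boundary) : A) = τ (x : A)) ∧
      peripheralSubalgebra (α : D.Boundary →⋆ₐ[ℂ] D.Boundary) = ⊤ := by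
  obtain ⟨E⟩ := DilationSpaces.nonempty τ
  exact ⟨⟨E.minimalDilation⟩, fun D =>
    ⟨D.boundaryAut, D.coe_boundaryAut, D.peripheralSubalgebra_boundaryAut⟩⟩
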